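/- Fix $T>0$ and a sequence $\varepsilon_n>0$ with $\varepsilon_n\to0$; we write $\varepsilon$ for $\varepsilon_n$. For each $\varepsilon$ let $(u^\varepsilon,p^\varepsilon)$, $u^\varepsilon(t,x)\in\mathbb R^3$, $p^\varepsilon(t,x)\in\mathbb R$, be a weak solution on $[0,T]\times\mathbb R^3$ of $$\partial_t u^\varepsilon+\nabla p^\varepsilon=\Delta u^\varepsilon-(u^\varepsilon\cdot\nabla)u^\varepsilon-\tfrac12(\operatorname{div}u^\varepsilon)u^\varepsilon,\qquad \varepsilon\,\partial_t p^\varepsilon+\operatorname{div}u^\varepsilon=0,$$ with initial data $u^\varepsilon(\cdot,0)=u^\varepsilon_0\in L^2(\mathbb R^3)$, $p^\varepsilon(\cdot,0)=p^\varepsilon_0\in L^2(\mathbb R^3)$. That is, $u^\varepsilon\in L^\infty([0,T];L^2(\mathbb R^3))$, $\nabla u^\varepsilon\in L^2([0,T]\times\mathbb R^3)$, $\sqrt\varepsilon\,p^\varepsilon\in L^\infty([0,T];L^2(\mathbb R^3))$, and the equations together with the initial conditions hold in the sense of distributions, tested against functions in $C_c^\infty([0,T)\times\mathbb R^3)$.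 Assume that for each $\varepsilon$ at least one of the following holds: either $u^\varepsilon\in L^4([0,T]\times\mathbb R^3)$, or $(u^\varepsilon,p^\varepsilon)$ satisfies, for almost every $t\in(0,T)$, the energy inequality $$\int_{\mathbb R^3}\Big(\tfrac12|u^\varepsilon(x,t)|^2+\tfrac\varepsilon2|p^\varepsilon(x,t)|^2\Big)dx+\int_0^t\!\!\int_{\mathbb R^3}|\nabla u^\varepsilon|^2\,dx\,ds\le\int_{\mathbb R^3}\Big(\tfrac12|u^\varepsilon_0|^2+\tfrac\varepsilon2|p^\varepsilon_0|^2\Big)dx .$$ Assume further that, as $\varepsilon\to0$, $u_0^\varepsilon\to u_0$ strongly in $L^2(\mathbb R^3)$ for some $u_0\in L^2(\mathbb R^3)$, and $\sqrt\varepsilon\,p_0^\varepsilon\to0$ strongly in $L^2(\mathbb R^3)$. Then, with bounds uniform in $\varepsilon$: 1. $\sqrt\varepsilon\,p^\varepsilon$ is bounded in $L^\infty([0,T];L^2(\mathbb R^3))$; 2. $\varepsilon\,\partial_t p^\varepsilon$ is relatively compact in $H^{-1}((0,T)\times\mathbb R^3)$, the dual of $H^1_0((0,T)\times\mathbb R^3)$;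 3. $\nabla u^\varepsilon$ is bounded in $L^2([0,T]\times\mathbb R^3)$; 4. $u^\varepsilon$ is bounded in $L^\infty([0,T];L^2(\mathbb R^3))\cap L^2([0,T];L^6(\mathbb R^3))$; 5. $(u^\varepsilon\cdot\nabla)u^\varepsilon$ is bounded in $L^2([0,T];L^1(\mathbb R^3))\cap L^1([0,T];L^{3/2}(\mathbb R^3))$; 6. $(\operatorname{div}u^\varepsilon)u^\varepsilon$ is bounded in $L^2([0,T];L^1(\mathbb R^3))\cap L^1([0,T];L^{3/2}(\mathbb R^3))$. -/

import Mathlib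

open MeasureTheory Set Filter Topology
open scoped ENNReal NNReal

namespace ArtComp

noncomputable section

/-- The physical space `ℝ³` with its Euclidean structure; it also carries the velocities. -/
abbrev E3 : Type := EuclideanSpace ℝ (Fin 3)

/-- Gradients of velocity fields: `G i` is the vector `∂ᵢu`. The norm is the Frobenius norm. -/
abbrev Grad3 : Type := PiLp 2 (fun _ : Fin 3 => E3)

/-- Lebesgue measure on the slab `(0,T) × ℝ³`. -/
def slab (T : ℝ) : Measure (ℝ × E3) :=
  (volume.restrict (Ioo 0 T)).prod volume

/-- The norm of `L^q(0,T; L^r(ℝ³))`, with values in `[0,∞]`. -/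
def mixedNorm {V : Type*} [NormedAddCommGroup V] (T : ℝ) (q r : ℝ≥0∞) (f : ℝ → E3 → V) : ℝ≥0∞ :=
  eLpNorm (fun t => eLpNorm (f t) r volume) q (volume.restrict (Ioo 0 T))

/-- `f ∈ L^q(0,T; L^r(ℝ³))`. -/
def MemMixed {V : Type*} [NormedAddCommGroup V] (T : ℝ) (q r : ℝ≥0∞) (f : ℝ → E3 → V) : Prop :=
  AEStronglyMeasurable (Function.uncurry f) (slab T) ∧ mixedNorm T q r f < ∞

/-- The sequence `f` is bounded in `L^q(0,T; L^r(ℝ³))`. -/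
def BoundedMixed {V : Type*} [NormedAddCommGroup V] (T : ℝ) (q r : ℝ≥0∞)
    (f : ℕ → ℝ → E3 → V) : Prop :=
  (∀ n, MemMixed T q r (f n)) ∧ ∃ C : ℝ≥0, ∀ n, mixedNorm T q r (f n) ≤ C

/-- Smooth functions whose support is compact and contained in `Ω`. -/
def IsTest {X V : Type*} [NormedAddCommGroup X] [NormedSpace ℝ X]
    [NormedAddCommGroup V] [NormedSpace ℝ V] (Ω : Set X) (φ : X → V) : Prop :=
  ContDiff ℝ ((⊤ : ℕ∞) : WithTop ℕ∞) φ ∧ HasCompactSupport φ ∧ tsupport φ ⊆ Ω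

/-- The `i`-th unit vector of `ℝ³`. -/
def unitVec (i : Fin 3) : E3 := EuclideanSpace.single i 1

/-- Time derivative of a function of `(t,x)`. -/
def dt {V : Type*} [NormedAddCommGroup V] [NormedSpace ℝ V] (φ : ℝ × E3 → V) (z : ℝ × E3) : V :=
  fderiv ℝ φ z (1, 0)

/-- The space derivative `∂ᵢ` of a function of `(t,x)`. -/
def dx {V : Type*} [NormedAddCommGroup V] [NormedSpace ℝ V] (i : Fin 3) (φ : ℝ × E3 → V)
    (z : ℝ × E3) : V :=
  fderiv ℝ φ z (0, unitVec i)

/-- `g` is the weak gradient on `ℝ³` of the vector field `v`. -/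
def IsWeakGrad (v : E3 → E3) (g : E3 → Grad3) : Prop :=
  LocallyIntegrable v ∧ LocallyIntegrable g ∧
    ∀ ψ : E3 → ℝ, IsTest univ ψ → ∀ i : Fin 3,
      ∫ x, fderiv ℝ ψ x (unitVec i) • v x = -∫ x, ψ x • g x i

/-- `(v · ∇) v = ∑ᵢ vᵢ ∂ᵢv`, where `g` is the gradient of `v`. -/
def convec (v : E3) (g : Grad3) : E3 := ∑ i, v i • g i

/-- `div v = ∑ᵢ ∂ᵢvᵢ`, where `g` is the gradient of `v`. -/
def divg (g : Grad3) : ℝ := ∑ i, g i i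

/-- Weak solutions on `[0,T] × ℝ³` of
`∂ₜu + ∇p = Δu - (u·∇)u - (1/2)(div u)u`, `ε ∂ₜp + div u = 0`, `u(0) = u₀`, `p(0) = p₀`,
with `u ∈ L^∞(0,T;L²)`, `∇u = G ∈ L²(0,T;L²)`, `√ε p ∈ L^∞(0,T;L²)`.
The test functions need not vanish at `t = 0`, which encodes the initial data. -/
structure IsWeakSolution (T ε : ℝ) (u₀ : E3 → E3) (p₀ : E3 → ℝ)
    (u : ℝ → E3 → E3) (G : ℝ → E3 → Grad3) (p : ℝ → E3 → ℝ) : Prop where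
  u₀_mem : MemLp u₀ 2 volume
  p₀_mem : MemLp p₀ 2 volume
  u_mem : MemMixed T ∞ 2 u
  G_mem : MemMixed T 2 2 G
  p_mem : MemMixed T ∞ 2 (fun t x => √ε * p t x)
  grad : ∀ᵐ t ∂volume.restrict (Ioo 0 T), IsWeakGrad (u t) (G t)
  momentum : ∀ φ : ℝ × E3 → E3, IsTest (Iio T ×ˢ univ) φ →
    ∫ z, (-inner ℝ (u z.1 z.2) (dt φ z)
        - p z.1 z.2 * (∑ i, dx i φ z i)
        + (∑ i, inner ℝ (G z.1 z.2 i) (dx i φ z))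
        + inner ℝ (convec (u z.1 z.2) (G z.1 z.2)) (φ z)
        + (1 / 2 : ℝ) * inner ℝ (divg (G z.1 z.2) • u z.1 z.2) (φ z)) ∂slab T
      = ∫ x, inner ℝ (u₀ x) (φ (0, x))
  continuity : ∀ ψ : ℝ × E3 → ℝ, IsTest (Iio T ×ˢ univ) ψ →
    ∫ z, (-(ε * p z.1 z.2 * dt ψ z) - ∑ i, u z.1 z.2 i * dx i ψ z) ∂slab T
      = ∫ x, ε * p₀ x * ψ (0, x)

/-- The energy inequality
`∫ (|u(t)|²/2 + ε|p(t)|²/2) dx + ∫₀ᵗ∫ |∇u|² dx ds ≤ ∫ (|u₀|²/2 + ε|p₀|²/2) dx`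
for almost every `t ∈ (0,T)`. -/
def EnergyInequality (T ε : ℝ) (u₀ : E3 → E3) (p₀ : E3 → ℝ)
    (u : ℝ → E3 → E3) (G : ℝ → E3 → Grad3) (p : ℝ → E3 → ℝ) : Prop :=
  ∀ᵐ t ∂volume.restrict (Ioo 0 T),
    (∫⁻ x, ENNReal.ofReal (‖u t x‖ ^ 2 / 2 + ε / 2 * p t x ^ 2))
        + ∫⁻ s in Ioo 0 t, ∫⁻ x, ENNReal.ofReal (‖G s x‖ ^ 2)
      ≤ ∫⁻ x, ENNReal.ofReal (‖u₀ x‖ ^ 2 / 2 + ε / 2 * p₀ x ^ 2)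

/-! ### The space `H⁻¹((0,T) × ℝ³)`, dual of `H¹₀((0,T) × ℝ³)` -/

/-- Values of `(φ, ∂ₜφ, ∇φ)`, with the Euclidean norm. -/
abbrev Jet : Type := WithLp 2 (ℝ × WithLp 2 (ℝ × E3))

/-- `z ↦ (φ(z), ∂ₜφ(z), ∇φ(z))`. -/
def jet (φ : ℝ × E3 → ℝ) (z : ℝ × E3) : Jet :=
  WithLp.toLp 2 (φ z, WithLp.toLp 2 (dt φ z, WithLp.toLp 2 (fun i => dx i φ z)))

theorem IsTest.memLp_jet {T : ℝ} {φ : ℝ × E3 → ℝ} (h : IsTest (Ioo 0 T ×ˢ univ) φ) :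
    MemLp (jet φ) 2 (slab T) := by
  have hd : Continuous (fderiv ℝ φ) := h.1.continuous_fderiv (by simp)
  have hc : Continuous (jet φ) := by
    unfold jet dt dx
    have := h.1.continuous
    fun_prop
  have hs : HasCompactSupport (jet φ) := by
    refine HasCompactSupport.intro h.2.1 fun z hz => ?_
    have h0 : φ z = 0 := image_eq_zero_of_notMem_tsupport hz
    have h1 : fderiv ℝ φ z = 0 :=
      image_eq_zero_of_notMem_tsupport fun hz' => hz (tsupport_fderiv_subset ℝ hz')
    simp only [jet, dt, dx, h0, h1]
    rfl
  unfold slab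
  exact hc.memLp_of_hasCompactSupport hs

/-- `H¹₀((0,T) × ℝ³)`: the closure of the test functions for the norm
`(∫∫ |φ|² + |∂ₜφ|² + |∇φ|²)^{1/2}`; a function is identified with its jet in `L²`. -/
def H10 (T : ℝ) : Submodule ℝ (Lp Jet 2 (slab T)) :=
  (Submodule.span ℝ {v | ∃ (φ : ℝ × E3 → ℝ) (h : IsTest (Ioo 0 T ×ˢ univ) φ),
    v = h.memLp_jet.toLp (jet φ)}).topologicalClosure

/-- A test function as an element of `H¹₀`. -/
def IsTest.toH10 {T : ℝ} {φ : ℝ × E3 → ℝ} (h : IsTest (Ioo 0 T ×ˢ univ) φ) : H10 T :=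
  ⟨h.memLp_jet.toLp (jet φ), subset_closure (Submodule.subset_span ⟨φ, h, rfl⟩)⟩

/-- `H⁻¹((0,T) × ℝ³)` with the dual norm. -/
abbrev Hm1 (T : ℝ) : Type := StrongDual ℝ (H10 T)

/-- The element `Λ` of `H⁻¹((0,T) × ℝ³)` is the distributional time derivative `∂ₜf`. -/
def IsTimeDeriv (T : ℝ) (f : ℝ → E3 → ℝ) (Λ : Hm1 T) : Prop :=
  ∀ (φ : ℝ × E3 → ℝ) (h : IsTest (Ioo 0 T ×ˢ univ) φ),
    Λ h.toH10 = -∫ z, f z.1 z.2 * dt φ z ∂slab T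

end

end ArtComp

namespace ArtComp

noncomputable section

open scoped Convolution

/-! ### Iterated norms and convolution in the space variable -/

/-! All bounds come from the energy inequality, whose right-hand side is bounded uniformly in `n`
because the initial data converge in the energy space. It bounds `√ε p` and `u` in `L^∞L²` and the
gradient in `L²`. The Sobolev inequality on time slices (`exists_mixedNorm_two_six_le`) turns the
gradient bound into `u ∈ L²L⁶`. Hölder then controls the quadratic terms: `L^∞L² · L²L²` lies in
`L²L¹`, and `L²L⁶ · L²L²` lies in `L¹L^{3/2}` (`boundedMixed_product`). Finally `ε p = √ε (√ε p)`
tends to `0` in `L²`, and `∂ₜ` is continuous from `L²` to `H⁻¹`; so `ε ∂ₜp` even converges to `0` in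
`H⁻¹`, and a convergent sequence is relatively compact (`exists_compact_timeDeriv`).

The real work is to derive the energy inequality, in fact an equality, when it is not assumed but `u
∈ L⁴` (`CoordSolution.energy_eq`). The equations are mollified in space only. Testing with `θ(t) k(x
- y)` shows that for each fixed `x` the mollified unknowns agree almost everywhere with absolutely
continuous functions of time having the prescribed initial values, so their squares obey the product
rule (`ae_sq_eq_of_weak_deriv`). Integrating over `x` and by parts, the pressure term cancels
against the divergence in the second equation and the viscous term gives the dissipation
(`integral_mollified_balance`).

The term `(1/2)(div u)u` makes the nonlinearity energy-neutral without incompressibility: its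
product with `w` is `(1/2) div(|w|² w)` (`integral_sum_nl_mul_eq_zero`). What is left is a
commutator between mollification and the nonlinearity. Since `u ∈ L⁴` and `∇u ∈ L²`, the
nonlinearity lies in `L^{4/3}`, the dual of `L⁴`; hence the commutator vanishes in `L^{4/3}` and its
pairing with the mollified velocity tends to `0` (`tendsto_integral_comm_mul`). -/

theorem eLpNorm_prod {X Y V : Type*} [MeasurableSpace X] [MeasurableSpace Y]
    [NormedAddCommGroup V] {μ : Measure X} {ν : Measure Y} [SFinite μ] [SFinite ν] {p : ℝ≥0∞}
    (hp0 : p ≠ 0) (hp : p ≠ ∞) {f : X × Y → V} (hf : AEStronglyMeasurable f (μ.prod ν)) :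
    eLpNorm f p (μ.prod ν) = eLpNorm (fun x => eLpNorm (fun y => f (x, y)) p ν) p μ := by
  simp only [eLpNorm_eq_lintegral_rpow_enorm_toReal hp0 hp]
  have h := ENNReal.toReal_pos hp0 hp
  simp only [enorm_eq_self, ← ENNReal.rpow_mul]
  rw [one_div_mul_cancel h.ne']
  simp only [ENNReal.rpow_one]
  rw [lintegral_prod _ (hf.enorm.pow_const _)]

/-- A form of Minkowski's integral inequality: Hölder in `y` for the finite measure `|k| μ`, then
Tonelli. The bound `M` is asked only where `k y ≠ 0`, so that for a mollifier only small
translations matter. Young's inequality and the convergence of mollifications both follow. -/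
theorem eLpNorm_integral_kernel_mul_le {X Y : Type*} [MeasurableSpace X] [MeasurableSpace Y]
    {ν : Measure X} {μ : Measure Y} [SFinite ν] [SFinite μ] {p : ℝ≥0∞} (hp1 : 1 ≤ p) (hp : p ≠ ∞)
    {k : Y → ℝ} (hk : Measurable k) (hki : Integrable k μ) {h : Y × X → ℝ} (hh : Measurable h)
    {M : ℝ≥0∞} (hM : ∀ y, k y ≠ 0 → eLpNorm (fun x => h (y, x)) p ν ≤ M) :
    eLpNorm (fun x => ∫ y, k y * h (y, x) ∂μ) p ν ≤ (∫⁻ y, ‖k y‖ₑ ∂μ) * M := by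
  have hp0 : p ≠ 0 := (zero_lt_one.trans_le hp1).ne'
  have hpp := ENNReal.toReal_pos hp0 hp
  set ρ : Measure Y := μ.withDensity (fun y => ‖k y‖ₑ) with hρ
  have hρu : ρ univ = ∫⁻ y, ‖k y‖ₑ ∂μ := by simp [hρ]
  have hρf : ρ univ ≠ ∞ := by rw [hρu]; exact hki.2.ne
  have : IsFiniteMeasure ρ := ⟨hρf.lt_top⟩
  have h1 : ∀ x, ‖∫ y, k y * h (y, x) ∂μ‖ₑ
      ≤ ‖eLpNorm (fun y => h (y, x)) p ρ * ρ univ ^ (1 - 1 / p.toReal)‖ₑ := by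
    intro x
    calc ‖∫ y, k y * h (y, x) ∂μ‖ₑ ≤ ∫⁻ y, ‖k y * h (y, x)‖ₑ ∂μ := enorm_integral_le_lintegral_enorm _
      _ = ∫⁻ y, ‖h (y, x)‖ₑ ∂ρ := by
        rw [hρ, lintegral_withDensity_eq_lintegral_mul _ hk.enorm (by fun_prop)]
        simp [enorm_mul]
      _ = eLpNorm (fun y => h (y, x)) 1 ρ := by rw [eLpNorm_one_eq_lintegral_enorm]
      _ ≤ _ := by
        have := eLpNorm_le_eLpNorm_mul_rpow_measure_univ (μ := ρ) (f := fun y => h (y, x)) hp1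
          (hh.comp measurable_prodMk_right).aestronglyMeasurable
        simpa using this
  -- After exchanging the two variables the norm in `x` is taken first, which is where `M` applies.
  have hswap : eLpNorm (fun z : X × Y => h (z.2, z.1)) p (ν.prod ρ) ≤ M * ρ univ ^ (1 / p.toReal) := by
    have : eLpNorm (fun z : X × Y => h (z.2, z.1)) p (ν.prod ρ) = eLpNorm h p (ρ.prod ν) :=
      eLpNorm_comp_measurePreserving (g := h) (f := Prod.swap) (p := p) (by fun_prop)
        Measure.measurePreserving_swap
    rw [this, eLpNorm_prod hp0 hp (by fun_prop)]
    calc _ ≤ eLpNorm (fun _ : Y => M) p ρ := by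
          refine eLpNorm_mono_enorm_ae ?_
          have : ∀ᵐ y ∂ρ, k y ≠ 0 := by
            rw [hρ, ae_withDensity_iff hk.enorm]
            filter_upwards with y hy
            simpa using hy
          filter_upwards [this] with y hy
          simpa using hM y hy
      _ ≤ _ := by
        rw [eLpNorm_eq_lintegral_rpow_enorm_toReal hp0 hp]
        simp only [enorm_eq_self, lintegral_const]
        rw [ENNReal.mul_rpow_of_nonneg _ _ (by positivity), ← ENNReal.rpow_mul,
          mul_one_div_cancel hpp.ne', ENNReal.rpow_one]
  calc eLpNorm (fun x => ∫ y, k y * h (y, x) ∂μ) p ν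
      ≤ eLpNorm (fun x => eLpNorm (fun y => h (y, x)) p ρ * ρ univ ^ (1 - 1 / p.toReal)) p ν :=
        eLpNorm_mono_enorm h1
    _ ≤ ρ univ ^ (1 - 1 / p.toReal) * eLpNorm (fun x => eLpNorm (fun y => h (y, x)) p ρ) p ν := by
        rw [eLpNorm_eq_lintegral_rpow_enorm_toReal hp0 hp, eLpNorm_eq_lintegral_rpow_enorm_toReal hp0 hp]
        simp only [enorm_eq_self]
        have h2 : (0:ℝ) ≤ 1 - 1 / p.toReal := by
          rw [sub_nonneg, div_le_one hpp]
          simpa using ENNReal.toReal_mono hp hp1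
        simp_rw [ENNReal.mul_rpow_of_nonneg _ _ hpp.le]
        rw [lintegral_mul_const' _ _ (by
          exact ENNReal.rpow_ne_top_of_nonneg hpp.le (ENNReal.rpow_ne_top_of_nonneg h2 hρf))]
        rw [ENNReal.mul_rpow_of_nonneg _ _ (by positivity), ← ENNReal.rpow_mul (ρ univ ^ _),
          mul_one_div_cancel hpp.ne', ENNReal.rpow_one, mul_comm]
    _ = ρ univ ^ (1 - 1 / p.toReal) * eLpNorm (fun z : X × Y => h (z.2, z.1)) p (ν.prod ρ) := by
        rw [eLpNorm_prod (f := fun z : X × Y => h (z.2, z.1)) hp0 hp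
          (hh.comp measurable_swap).aestronglyMeasurable]
    _ ≤ ρ univ ^ (1 - 1 / p.toReal) * (M * ρ univ ^ (1 / p.toReal)) := by gcongr
    _ = ρ univ * M := by
        -- The exponents `1 - 1/p` and `1/p` add up to `1`; adding them requires a nonzero total
        -- mass.
        by_cases h0 : ρ univ = 0
        · rw [h0, ENNReal.zero_rpow_of_pos (by positivity : 0 < 1 / p.toReal)]; simp
        rw [mul_left_comm, ← ENNReal.rpow_add _ _ h0 hρf]
        simp [mul_comm]
    _ = _ := by rw [hρu]

/-- Convolution in the space variable. -/
def sconv (k : E3 → ℝ) (f : ℝ × E3 → ℝ) (z : ℝ × E3) : ℝ := ∫ y, k y * f (z.1, z.2 - y)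

theorem sconv_eq_convolution (k : E3 → ℝ) (f : ℝ × E3 → ℝ) (t : ℝ) (x : E3) :
    sconv k f (t, x) = (k ⋆[ContinuousLinearMap.lsmul ℝ ℝ] fun y => f (t, y)) x := by
  simp [sconv, convolution_def]

theorem convolution_lsmul_eq (k f : E3 → ℝ) (x : E3) :
    (k ⋆[ContinuousLinearMap.lsmul ℝ ℝ] f) x = ∫ y, k (x - y) * f y := by
  rw [convolution_eq_swap]; simp

theorem sconv_eq (k : E3 → ℝ) (f : ℝ × E3 → ℝ) (t : ℝ) (x : E3) :
    sconv k f (t, x) = ∫ y, k (x - y) * f (t, y) := by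
  rw [sconv_eq_convolution, convolution_lsmul_eq]

theorem measurable_sconv {k : E3 → ℝ} {f : ℝ × E3 → ℝ} (hk : Measurable k) (hf : Measurable f) :
    Measurable (sconv k f) := by
  have h : StronglyMeasurable fun w : (ℝ × E3) × E3 => k w.2 * f (w.1.1, w.1.2 - w.2) :=
    Measurable.stronglyMeasurable (by fun_prop)
  exact h.integral_prod_right.measurable

theorem measurePreserving_slab_sub (T : ℝ) (y : E3) :
    MeasurePreserving (fun z : ℝ × E3 => (z.1, z.2 - y)) (slab T) (slab T) := by
  unfold slab
  exact (MeasurePreserving.id _).prod (measurePreserving_sub_right volume y)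

instance (T : ℝ) : SFinite (slab T) := by unfold slab; infer_instance

/-- Young's inequality: spatial translations preserve the measure of the slab, so every translate of
`f` has the norm of `f`. -/
theorem eLpNorm_sconv_le {T : ℝ} {p : ℝ≥0∞} (hp1 : 1 ≤ p) (hp : p ≠ ∞) {k : E3 → ℝ}
    (hk : Measurable k) (hki : Integrable k) {f : ℝ × E3 → ℝ} (hf : Measurable f) :
    eLpNorm (sconv k f) p (slab T) ≤ (∫⁻ y, ‖k y‖ₑ) * eLpNorm f p (slab T) := by
  refine eLpNorm_integral_kernel_mul_le (X := ℝ × E3) (ν := slab T) hp1 hp hk hki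
    (h := fun w => f (w.2.1, w.2.2 - w.1)) (by fun_prop) fun y _ => le_of_eq ?_
  exact eLpNorm_comp_measurePreserving (g := f) (by fun_prop) (measurePreserving_slab_sub T y)

theorem MemLp.sconv {T : ℝ} {p : ℝ≥0∞} (hp1 : 1 ≤ p) (hp : p ≠ ∞) {k : E3 → ℝ}
    (hk : Measurable k) (hki : Integrable k) {f : ℝ × E3 → ℝ} (hf : Measurable f)
    (hfp : MemLp f p (slab T)) : MemLp (sconv k f) p (slab T) :=
  ⟨(measurable_sconv hk hf).aestronglyMeasurable,
    (eLpNorm_sconv_le hp1 hp hk hki hf).trans_lt (ENNReal.mul_lt_top hki.2 hfp.2)⟩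

theorem eLpNorm_convolution_le {p : ℝ≥0∞} (hp1 : 1 ≤ p) (hp : p ≠ ∞) {k : E3 → ℝ}
    (hk : Measurable k) (hki : Integrable k) {f : E3 → ℝ} (hf : Measurable f) :
    eLpNorm (k ⋆[ContinuousLinearMap.lsmul ℝ ℝ] f) p volume
      ≤ (∫⁻ y, ‖k y‖ₑ) * eLpNorm f p volume := by
  refine eLpNorm_integral_kernel_mul_le (ν := (volume : Measure E3)) hp1 hp hk hki
    (h := fun w => f (w.2 - w.1)) (by fun_prop) fun y _ => le_of_eq ?_
  exact eLpNorm_comp_measurePreserving (g := f) (by fun_prop) (measurePreserving_sub_right volume y)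

theorem slab_eq_restrict (T : ℝ) : slab T = volume.restrict (Ioo 0 T ×ˢ univ) := by
  rw [slab, Measure.volume_eq_prod, ← Measure.prod_restrict, Measure.restrict_univ]

/-- Translations act continuously on `L^p` for finite `p`. This is an instance of the continuity of
composition with measure-preserving maps in the compact-open topology. -/
theorem tendsto_eLpNorm_translate_sub {T : ℝ} {p : ℝ≥0∞} (hp1 : 1 ≤ p) (hp : p ≠ ∞)
    {f : ℝ × E3 → ℝ} (hf : MemLp f p (slab T)) :
    Tendsto (fun y : E3 => eLpNorm (fun z => f (z.1, z.2 - y) - f z) p (slab T)) (𝓝 0) (𝓝 0) := by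
  have : Fact (1 ≤ p) := ⟨hp1⟩
  have : IsLocallyFiniteMeasure (slab T) := by rw [slab_eq_restrict]; infer_instance
  let g : C(E3, C(ℝ × E3, ℝ × E3)) :=
    ContinuousMap.curry ⟨fun w : E3 × (ℝ × E3) => (w.2.1, w.2.2 - w.1), by fun_prop⟩
  have hg : Tendsto g (𝓝 0) (𝓝 (g 0)) := g.continuous.tendsto 0
  have hgm : ∀ y, MeasurePreserving (g y) (slab T) (slab T) := measurePreserving_slab_sub T
  have h2 := ((tendsto_const_nhds (x := hf.toLp f) (f := 𝓝 (0 : E3))).compMeasurePreservingLp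
    hg hgm (hgm 0) hp).edist (tendsto_const_nhds (x := hf.toLp f))
  have h0 : Lp.compMeasurePreserving (g 0) (hgm 0) (hf.toLp f) = hf.toLp f := by
    rw [Lp.toLp_compMeasurePreserving]
    congr 1
    ext z
    simp [g]
  rw [h0, edist_self] at h2
  refine h2.congr fun y => ?_
  rw [Lp.toLp_compMeasurePreserving, Lp.edist_toLp_toLp]
  rfl

/-! ### Mollifiers -/

/-- The bump functions behind the mollifiers. -/
def mollBump (n : ℕ) : ContDiffBump (0 : E3) where
  rIn := 1 / (2 * (n + 1))
  rOut := 1 / (n + 1)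
  rIn_pos := by positivity
  rIn_lt_rOut := by
    rw [div_lt_div_iff_of_pos_left one_pos (by positivity) (by positivity)]
    have : (0 : ℝ) ≤ n := n.cast_nonneg
    linarith

/-- A sequence of smooth mollifiers on `ℝ³`. -/
def moll (n : ℕ) : E3 → ℝ := (mollBump n).normed volume

theorem tendsto_mollBump_rOut : Tendsto (fun n => (mollBump n).rOut) atTop (𝓝 0) :=
  tendsto_one_div_add_atTop_nhds_zero_nat

theorem isTest_moll (n : ℕ) : IsTest univ (moll n) :=
  ⟨(mollBump n).contDiff_normed, (mollBump n).hasCompactSupport_normed, subset_univ _⟩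

theorem moll_nonneg (n : ℕ) (x : E3) : 0 ≤ moll n x := (mollBump n).nonneg_normed x

theorem integral_moll (n : ℕ) : ∫ x, moll n x = 1 := (mollBump n).integral_normed

theorem norm_lt_of_moll_ne_zero {n : ℕ} {x : E3} (h : moll n x ≠ 0) : ‖x‖ < (mollBump n).rOut := by
  have : x ∈ Function.support (moll n) := h
  rw [moll, ContDiffBump.support_normed_eq] at this
  simpa using this

theorem ae_tendsto_moll_convolution {f : E3 → ℝ} (hf : LocallyIntegrable f) :
    ∀ᵐ x, Tendsto (fun n => (moll n ⋆[ContinuousLinearMap.lsmul ℝ ℝ] f) x) atTop (𝓝 (f x)) := by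
  -- `K = 2` is the fixed ratio of the outer to the inner radius of the bumps.
  refine ContDiffBump.ae_convolution_tendsto_right_of_locallyIntegrable (φ := mollBump) (K := 2)
    tendsto_mollBump_rOut (Eventually.of_forall fun n => le_of_eq ?_) hf
  simp only [mollBump]
  field_simp

theorem IsTest.continuous {k : E3 → ℝ} (hk : IsTest univ k) : Continuous k := hk.1.continuous

theorem IsTest.integrable {k : E3 → ℝ} (hk : IsTest univ k) : Integrable k :=
  hk.continuous.integrable_of_hasCompactSupport hk.2.1

theorem lintegral_enorm_moll (n : ℕ) : ∫⁻ x, ‖moll n x‖ₑ = 1 := by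
  have h := ofReal_integral_norm_eq_lintegral_enorm (isTest_moll n).integrable
  rw [← h]
  simp [Real.norm_of_nonneg (moll_nonneg n _), integral_moll]

/-- The partial derivatives of a function on `ℝ³`. -/
def pd (i : Fin 3) (k : E3 → ℝ) (x : E3) : ℝ := fderiv ℝ k x (unitVec i)

theorem IsTest.pd {k : E3 → ℝ} (hk : IsTest univ k) (i : Fin 3) : IsTest univ (pd i k) := by
  refine ⟨?_, ?_, subset_univ _⟩
  · exact (hk.1.fderiv_right (m := ((⊤ : ℕ∞) : WithTop ℕ∞)) (by simp)).clm_apply contDiff_const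
  · exact hk.2.1.fderiv_apply ℝ _

theorem convolution_integrand_integrable {k f : E3 → ℝ} (hk : IsTest univ k)
    (hf : LocallyIntegrable f) (x : E3) : Integrable fun y => k y * f (x - y) :=
  (hk.2.1.convolutionExists_left (ContinuousLinearMap.lsmul ℝ ℝ) hk.continuous hf x).congr
    (by simp)

theorem contDiff_convolution {k f : E3 → ℝ} (hk : IsTest univ k) (hf : LocallyIntegrable f) :
    ContDiff ℝ ((⊤ : ℕ∞) : WithTop ℕ∞) (k ⋆[ContinuousLinearMap.lsmul ℝ ℝ] f) :=
  hk.2.1.contDiff_convolution_left _ hk.1 hf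

theorem pd_convolution {k f : E3 → ℝ} (hk : IsTest univ k) (hf : LocallyIntegrable f)
    (i : Fin 3) :
    pd i (k ⋆[ContinuousLinearMap.lsmul ℝ ℝ] f)
      = (pd i k) ⋆[ContinuousLinearMap.lsmul ℝ ℝ] f := by
  ext x
  have h := hk.2.1.hasFDerivAt_convolution_left (ContinuousLinearMap.lsmul ℝ ℝ) (hk.1.of_le (by simp)) hf x
  rw [pd, h.fderiv]
  have hi : ConvolutionExistsAt (fderiv ℝ k) f x
      ((ContinuousLinearMap.lsmul ℝ ℝ : ℝ →L[ℝ] ℝ →L[ℝ] ℝ).precompL E3) volume :=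
    (hk.2.1.fderiv ℝ).convolutionExists_left _ (hk.1.continuous_fderiv (by simp)) hf x
  rw [convolution_def, ContinuousLinearMap.integral_apply hi, convolution_def]
  simp [pd]

theorem memLp_convolution {p : ℝ≥0∞} (hp1 : 1 ≤ p) (hp : p ≠ ∞) {k f : E3 → ℝ}
    (hk : IsTest univ k) (hf : Measurable f) (hfp : MemLp f p) :
    MemLp (k ⋆[ContinuousLinearMap.lsmul ℝ ℝ] f) p :=
  ⟨(contDiff_convolution hk (hfp.locallyIntegrable hp1)).continuous.aestronglyMeasurable,
    (eLpNorm_convolution_le hp1 hp hk.continuous.measurable hk.integrable hf).trans_lt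
      (ENNReal.mul_lt_top hk.integrable.2 hfp.2)⟩

theorem eLpNorm_moll_convolution_le {p : ℝ≥0∞} (hp1 : 1 ≤ p) (hp : p ≠ ∞) (n : ℕ) {f : E3 → ℝ}
    (hf : Measurable f) :
    eLpNorm (moll n ⋆[ContinuousLinearMap.lsmul ℝ ℝ] f) p volume ≤ eLpNorm f p volume := by
  simpa [lintegral_enorm_moll] using eLpNorm_convolution_le hp1 hp
    (isTest_moll n).continuous.measurable (isTest_moll n).integrable hf

theorem ae_memLp_slice {T : ℝ} {V : Type*} [NormedAddCommGroup V] {p : ℝ≥0∞} (hp0 : p ≠ 0)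
    (hp : p ≠ ∞) {f : ℝ × E3 → V} (hf : MemLp f p (slab T)) :
    ∀ᵐ t ∂volume.restrict (Ioo 0 T), MemLp (fun x => f (t, x)) p := by
  have h1 := hf.2
  have hm : AEStronglyMeasurable f ((volume.restrict (Ioo 0 T)).prod volume) := hf.1
  rw [slab, eLpNorm_lt_top_iff_lintegral_rpow_enorm_lt_top hp0 hp,
    lintegral_prod _ (hm.enorm.pow_const _)] at h1
  have h2 := ae_lt_top' (hm.enorm.pow_const _).lintegral_prod_right' h1.ne
  filter_upwards [h2, hm.prodMk_left] with t ht htm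
  exact ⟨htm, by rwa [eLpNorm_lt_top_iff_lintegral_rpow_enorm_lt_top hp0 hp]⟩

/-- As the mollifier has integral `1`, the difference is an average of `f(· - y) - f` over small
`y`; each of these is small in `L^p` by continuity of translations. -/
theorem tendsto_eLpNorm_sconv_moll_sub {T : ℝ} {p : ℝ≥0∞} (hp1 : 1 ≤ p) (hp : p ≠ ∞)
    {f : ℝ × E3 → ℝ} (hfm : Measurable f) (hf : MemLp f p (slab T)) :
    Tendsto (fun n => eLpNorm (fun z => sconv (moll n) f z - f z) p (slab T)) atTop (𝓝 0) := by
  rw [ENNReal.tendsto_nhds_zero]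
  intro ε hε
  have h1 := ENNReal.tendsto_nhds_zero.1 (tendsto_eLpNorm_translate_sub hp1 hp hf) ε hε
  obtain ⟨δ, hδ, hball⟩ := Metric.eventually_nhds_iff_ball.1 h1
  filter_upwards [tendsto_mollBump_rOut.eventually (gt_mem_nhds hδ)] with n hn
  have hp0 : p ≠ 0 := (zero_lt_one.trans_le hp1).ne'
  have h2 : (fun z => sconv (moll n) f z - f z)
      =ᵐ[slab T] fun z => ∫ y, moll n y * (f (z.1, z.2 - y) - f z) := by
    have hkm := (isTest_moll n).continuous.measurable
    have hm1 : Measurable (sconv (moll n) f) := measurable_sconv hkm hfm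
    have hm2 : Measurable fun z : ℝ × E3 => ∫ y, moll n y * (f (z.1, z.2 - y) - f z) := by
      have h : StronglyMeasurable fun w : (ℝ × E3) × E3 =>
          moll n w.2 * (f (w.1.1, w.1.2 - w.2) - f w.1) :=
        Measurable.stronglyMeasurable (by fun_prop)
      exact h.integral_prod_right.measurable
    rw [slab]
    refine Measure.ae_prod_iff_ae_ae (measurableSet_eq_fun (hm1.sub hfm) hm2) |>.2 ?_
    -- Splitting the integral needs the slice to be locally integrable, hence the identity is only
    -- claimed for almost every time.
    filter_upwards [ae_memLp_slice hp0 hp hf] with t ht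
    filter_upwards with x
    have hi := convolution_integrand_integrable (isTest_moll n) (ht.locallyIntegrable hp1) x
    change (∫ y, moll n y * f (t, x - y)) - f (t, x) = ∫ y, moll n y * (f (t, x - y) - f (t, x))
    simp only [mul_sub]
    rw [integral_sub hi ((isTest_moll n).integrable.mul_const _), integral_mul_const,
      integral_moll, one_mul]
  rw [eLpNorm_congr_ae h2]
  have := eLpNorm_integral_kernel_mul_le (ν := slab T) (μ := (volume : Measure E3)) hp1 hp
    (isTest_moll n).continuous.measurable (isTest_moll n).integrable
    (h := fun w => f (w.2.1, w.2.2 - w.1) - f w.2) (by fun_prop) (M := ε) fun y hy =>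
      hball y (by simpa using (norm_lt_of_moll_ne_zero hy).trans hn)
  simpa [lintegral_enorm_moll] using this

/-! ### Integration by parts and weak derivatives -/

/-- All products involved are integrable as products of `L²` functions, so integration by parts
leaves no term at infinity. -/
theorem integral_pd_convolution_mul {k f g : E3 → ℝ} (hk : IsTest univ k) (hfm : Measurable f)
    (hgm : Measurable g) (hf : MemLp f 2) (hg : MemLp g 2) (i : Fin 3) :
    ∫ x, (pd i k ⋆[ContinuousLinearMap.lsmul ℝ ℝ] f) x * (k ⋆[ContinuousLinearMap.lsmul ℝ ℝ] g) x
      = -∫ x, (k ⋆[ContinuousLinearMap.lsmul ℝ ℝ] f) x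
          * (pd i k ⋆[ContinuousLinearMap.lsmul ℝ ℝ] g) x := by
  have hfl := hf.locallyIntegrable one_le_two
  have hgl := hg.locallyIntegrable one_le_two
  have h2 : (2 : ℝ≥0∞) ≠ ∞ := by simp
  have key := integral_mul_fderiv_eq_neg_fderiv_mul_of_integrable (μ := (volume : Measure E3))
    (f := k ⋆[ContinuousLinearMap.lsmul ℝ ℝ] f) (g := k ⋆[ContinuousLinearMap.lsmul ℝ ℝ] g)
    (v := unitVec i) ?_ ?_ ?_ ?_ ?_
  · rw [← pd_convolution hk hfl, ← pd_convolution hk hgl]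
    simp only [pd]
    rw [key, neg_neg]
  · change Integrable fun x => pd i (k ⋆[ContinuousLinearMap.lsmul ℝ ℝ] f) x * _
    rw [pd_convolution hk hfl]
    exact (memLp_convolution one_le_two h2 (hk.pd i) hfm hf).integrable_mul
      (memLp_convolution one_le_two h2 hk hgm hg)
  · change Integrable fun x => _ * pd i (k ⋆[ContinuousLinearMap.lsmul ℝ ℝ] g) x
    rw [pd_convolution hk hgl]
    exact (memLp_convolution one_le_two h2 hk hfm hf).integrable_mul
      (memLp_convolution one_le_two h2 (hk.pd i) hgm hg)
  · exact (memLp_convolution one_le_two h2 hk hfm hf).integrable_mul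
      (memLp_convolution one_le_two h2 hk hgm hg)
  · exact fun x _ => (contDiff_convolution hk hfl).differentiable (by simp) x
  · exact fun x _ => (contDiff_convolution hk hgl).differentiable (by simp) x

/-- `g` is the weak partial derivative `∂ᵢv` of the scalar function `v` on `ℝ³`. -/
def IsWeakPartial (i : Fin 3) (v g : E3 → ℝ) : Prop :=
  LocallyIntegrable v ∧ LocallyIntegrable g ∧
    ∀ ψ : E3 → ℝ, IsTest univ ψ → ∫ x, pd i ψ x * v x = -∫ x, ψ x * g x

theorem integral_coord {f : E3 → E3} (hf : Integrable f) (j : Fin 3) :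
    (∫ x, f x) j = ∫ x, f x j := by
  have := (EuclideanSpace.proj (𝕜 := ℝ) (ι := Fin 3) j).integral_comp_comm hf
  simpa using this.symm

theorem LocallyIntegrable.coord {f : E3 → E3} (hf : LocallyIntegrable f) (j : Fin 3) :
    LocallyIntegrable fun x => f x j := fun x => by
  obtain ⟨s, hs, hi⟩ := hf x
  exact ⟨s, hs, (EuclideanSpace.proj (𝕜 := ℝ) (ι := Fin 3) j).integrable_comp hi⟩

theorem IsWeakGrad.isWeakPartial {v : E3 → E3} {g : E3 → Grad3} (h : IsWeakGrad v g)
    (i j : Fin 3) : IsWeakPartial i (fun x => v x j) (fun x => g x i j) := by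
  obtain ⟨hv, hg, h⟩ := h
  have hgi : LocallyIntegrable fun x => g x i := fun x => by
    obtain ⟨s, hs, hi⟩ := hg x
    exact ⟨s, hs, (PiLp.proj 2 (𝕜 := ℝ) (fun _ : Fin 3 => E3) i).integrable_comp hi⟩
  refine ⟨LocallyIntegrable.coord hv j, LocallyIntegrable.coord hgi j, fun ψ hψ => ?_⟩
  have h1 := congrArg (fun w : E3 => w j) (h ψ hψ i)
  have i1 : Integrable fun x => fderiv ℝ ψ x (unitVec i) • v x :=
    hv.integrable_smul_left_of_hasCompactSupport (hψ.pd i).continuous (hψ.pd i).2.1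
  have i2 : Integrable fun x => ψ x • g x i :=
    hgi.integrable_smul_left_of_hasCompactSupport hψ.continuous hψ.2.1
  simp only [PiLp.neg_apply] at h1
  rw [integral_coord i1, integral_coord i2] at h1
  simpa [pd] using h1

theorem IsTest.reflect {k : E3 → ℝ} (hk : IsTest univ k) (x : E3) :
    IsTest univ fun y => k (x - y) := by
  refine ⟨hk.1.comp (contDiff_const.sub contDiff_id), ?_, subset_univ _⟩
  exact hk.2.1.comp_homeomorph (Homeomorph.subLeft x)

theorem pd_reflect {k : E3 → ℝ} (hk : IsTest univ k) (i : Fin 3) (x y : E3) :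
    pd i (fun y => k (x - y)) y = -pd i k (x - y) := by
  have h1 : HasFDerivAt (fun y : E3 => x - y) (-ContinuousLinearMap.id ℝ E3) y :=
    (hasFDerivAt_id y).const_sub x
  have h2 := ((hk.1.differentiable (by simp)) (x - y)).hasFDerivAt.comp y h1
  have h3 : HasFDerivAt (fun y => k (x - y)) _ y := h2
  simp [pd, h3.fderiv]

/-- Test the weak derivative with `y ↦ k (x - y)`: the sign from the reflection cancels the sign of
integration by parts. -/
theorem pd_convolution_of_isWeakPartial {k v g : E3 → ℝ} (hk : IsTest univ k) {i : Fin 3}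
    (h : IsWeakPartial i v g) :
    pd i k ⋆[ContinuousLinearMap.lsmul ℝ ℝ] v = k ⋆[ContinuousLinearMap.lsmul ℝ ℝ] g := by
  ext x
  have := h.2.2 _ (hk.reflect x)
  simp only [pd_reflect hk, neg_mul, integral_neg, neg_inj] at this
  rw [convolution_lsmul_eq, convolution_lsmul_eq, this]

/-! ### Distributional derivatives in time -/

/-- Admissible `θ` need not vanish at `0`, so `ζ` need not have zero mean: the primitive is taken
from the right of its support. -/
theorem exists_test_primitive {T : ℝ} (hT : 0 < T) {ζ : ℝ → ℝ} (hζ : IsTest (Ioo 0 T) ζ) :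
    ∃ θ : ℝ → ℝ, IsTest (Iio T) θ ∧ ∀ t ∈ Ioo 0 T, deriv θ t = ζ t := by
  obtain ⟨hs, hc, hsub⟩ := hζ
  obtain ⟨b, hbT, hb⟩ : ∃ b < T, ∀ t, b < t → ζ t = 0 := by
    rcases (tsupport ζ).eq_empty_or_nonempty with h | h
    · refine ⟨0, hT, fun t _ => image_eq_zero_of_notMem_tsupport (by simp [h])⟩
    · obtain ⟨b, hb, hmax⟩ := IsCompact.exists_isGreatest hc h
      exact ⟨b, (hsub hb).2, fun t ht => image_eq_zero_of_notMem_tsupport fun h' =>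
        absurd (hmax h') (not_le.2 ht)⟩
  have hint : ∀ x y, IntervalIntegrable ζ volume x y := fun x y => hs.continuous.intervalIntegrable x y
  set Z : ℝ → ℝ := fun t => ∫ s in b..t, ζ s with hZ
  have hZd : ∀ t, HasDerivAt Z (ζ t) t := fun t =>
    (intervalIntegral.integral_hasStrictDerivAt_right (hint b t)
      (hs.continuous.stronglyMeasurableAtFilter _ _) hs.continuous.continuousAt).hasDerivAt
  have hZs : ContDiff ℝ ((⊤ : ℕ∞) : WithTop ℕ∞) Z := by
    refine contDiff_infty_iff_deriv.2 ⟨fun t => (hZd t).differentiableAt, ?_⟩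
    rwa [show deriv Z = ζ from funext fun t => (hZd t).deriv]
  have hZ0 : ∀ t, b < t → Z t = 0 := fun t ht => by
    rw [hZ]
    simp only
    rw [intervalIntegral.integral_congr_ae (g := fun _ => 0), intervalIntegral.integral_zero]
    refine Eventually.of_forall fun s hsm => hb s ?_
    rw [uIoc_of_le ht.le] at hsm
    exact hsm.1
  -- To the left of the support of `ζ` the primitive is a constant, possibly nonzero; `χ` equals `1`
  -- on `[0,T]` and restores compact support.
  let χ : ContDiffBump (0 : ℝ) := ⟨T + 1, T + 2, by linarith, by linarith⟩
  refine ⟨fun t => χ t * Z t, ⟨χ.contDiff.mul hZs, χ.hasCompactSupport.mul_right, ?_⟩, ?_⟩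
  · have h1 : Function.support (fun t => χ t * Z t) ⊆ Iic b := fun t ht => by
      by_contra hbt
      exact ht (by simp [hZ0 t (not_le.1 hbt)])
    exact (closure_minimal h1 isClosed_Iic).trans fun t ht => lt_of_le_of_lt ht hbT
  · intro t ht
    have h1 : (fun t => χ t * Z t) =ᶠ[𝓝 t] Z := by
      have : t ∈ Metric.ball (0 : ℝ) (T + 1) := by
        rw [Metric.mem_ball, dist_zero_right, Real.norm_of_nonneg ht.1.le]
        linarith [ht.2]
      filter_upwards [χ.eventuallyEq_one_of_mem_ball this] with s h
      simp [h]
    rw [h1.deriv_eq, (hZd t).deriv]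

/-- The absolutely continuous function `a + ∫ h` satisfies the same identity as `f`, by integration
by parts. The difference is thus orthogonal to every `θ'`, hence to every test function on `(0,T)`.
No additive constant remains undetermined, because `θ 0` is free. -/
theorem ae_eq_primitive_of_weak_deriv {T : ℝ} (hT : 0 < T) {f h : ℝ → ℝ} {a : ℝ}
    (hf : IntegrableOn f (Ioo 0 T)) (hh : IntegrableOn h (Ioo 0 T))
    (H : ∀ θ : ℝ → ℝ, IsTest (Iio T) θ →
      -∫ t in Ioo 0 T, deriv θ t * f t = θ 0 * a + ∫ t in Ioo 0 T, θ t * h t) :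
    ∀ᵐ t ∂volume.restrict (Ioo 0 T), f t = a + ∫ s in (0)..t, h s := by
  have hhi : IntervalIntegrable h volume 0 T := by
    rwa [intervalIntegrable_iff_integrableOn_Ioo_of_le hT.le]
  set P : ℝ → ℝ := fun t => a + ∫ s in (0)..t, h s with hP
  have hPac : AbsolutelyContinuousOnInterval P 0 T := by
    have h1 := hhi.absolutelyContinuousOnInterval_intervalIntegral (c := 0) (by simp)
    have h2 : AbsolutelyContinuousOnInterval (fun _ : ℝ => a) 0 T :=
      contDiffOn_const.absolutelyContinuousOnInterval
    exact h2.add h1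
  have hPd : ∀ᵐ x, x ∈ Ioo 0 T → deriv P x = h x := by
    filter_upwards [hhi.ae_hasDerivAt_integral] with x hx hxT
    have := hx (by rw [uIcc_of_le hT.le]; exact Ioo_subset_Icc_self hxT) 0 (by simp)
    exact (this.const_add a).deriv
  have hPint : IntegrableOn P (Ioo 0 T) :=
    ((hPac.continuousOn.integrableOn_compact isCompact_uIcc).mono_set
      (by rw [uIcc_of_le hT.le]; exact Ioo_subset_Icc_self))
  have key : ∀ ζ : ℝ → ℝ, IsTest (Ioo 0 T) ζ → ∫ t in Ioo 0 T, ζ t * (f t - P t) = 0 := by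
    intro ζ hζ
    obtain ⟨θ, hθ, hd⟩ := exists_test_primitive hT hζ
    -- This removes the boundary term at `T`; the one at `0` supplies `θ 0 * a`.
    have hθT : θ T = 0 := image_eq_zero_of_notMem_tsupport fun h => lt_irrefl T (hθ.2.2 h)
    have hθac : AbsolutelyContinuousOnInterval θ 0 T :=
      (hθ.1.of_le (by simp)).contDiffOn.absolutelyContinuousOnInterval
    have h1 := hPac.integral_mul_deriv_eq_deriv_mul hθac
    have h2 := H θ hθ
    have hP0 : P 0 = a := by simp [hP]
    rw [hθT, hP0, intervalIntegral.integral_of_le hT.le, intervalIntegral.integral_of_le hT.le,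
      integral_Ioc_eq_integral_Ioo, integral_Ioc_eq_integral_Ioo] at h1
    have h3 : ∫ t in Ioo 0 T, deriv P t * θ t = ∫ t in Ioo 0 T, θ t * h t := by
      refine setIntegral_congr_ae measurableSet_Ioo ?_
      filter_upwards [hPd] with t ht htT
      rw [ht htT, mul_comm]
    have h4 : ∫ t in Ioo 0 T, P t * deriv θ t = ∫ t in Ioo 0 T, ζ t * P t :=
      setIntegral_congr_fun measurableSet_Ioo fun t ht => by simp only [hd t ht, mul_comm]
    have h5 : ∫ t in Ioo 0 T, deriv θ t * f t = ∫ t in Ioo 0 T, ζ t * f t :=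
      setIntegral_congr_fun measurableSet_Ioo fun t ht => by simp only [hd t ht]
    rw [h3, h4] at h1
    rw [h5] at h2
    obtain ⟨C, hC⟩ := hζ.2.1.exists_bound_of_continuous hζ.1.continuous
    have i1 : IntegrableOn (fun t => ζ t * f t) (Ioo 0 T) :=
      hf.bdd_mul hζ.1.continuous.aestronglyMeasurable (Eventually.of_forall hC)
    have i2 : IntegrableOn (fun t => ζ t * P t) (Ioo 0 T) :=
      hPint.bdd_mul hζ.1.continuous.aestronglyMeasurable (Eventually.of_forall hC)
    simp only [mul_sub]
    rw [integral_sub i1 i2, h1]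
    linarith
  have hloc : LocallyIntegrableOn (fun t => f t - P t) (Ioo 0 T) :=
    (hf.sub hPint).locallyIntegrableOn
  have := isOpen_Ioo.ae_eq_zero_of_integral_contDiff_smul_eq_zero hloc (fun g h1 h2 h3 => by
    have := key g ⟨h1, h2, h3⟩
    rw [setIntegral_eq_integral_of_forall_compl_eq_zero] at this
    · simpa using this
    · intro t ht
      rw [image_eq_zero_of_notMem_tsupport fun h => ht (h3 h), zero_mul])
  rw [ae_restrict_iff' measurableSet_Ioo]
  filter_upwards [this] with t ht htT
  linarith [ht htT]

/-- The product rule for the absolutely continuous representative; under the integral it may be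
replaced by `f` again. -/
theorem ae_sq_eq_of_weak_deriv {T : ℝ} (hT : 0 < T) {f h : ℝ → ℝ} {a : ℝ}
    (hf : IntegrableOn f (Ioo 0 T)) (hh : IntegrableOn h (Ioo 0 T))
    (H : ∀ θ : ℝ → ℝ, IsTest (Iio T) θ →
      -∫ t in Ioo 0 T, deriv θ t * f t = θ 0 * a + ∫ t in Ioo 0 T, θ t * h t) :
    ∀ᵐ t ∂volume.restrict (Ioo 0 T), f t ^ 2 = a ^ 2 + 2 * ∫ s in Ioo 0 t, h s * f s := by
  have hfP := ae_eq_primitive_of_weak_deriv hT hf hh H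
  have hhi : IntervalIntegrable h volume 0 T := by
    rwa [intervalIntegrable_iff_integrableOn_Ioo_of_le hT.le]
  set P : ℝ → ℝ := fun t => a + ∫ s in (0)..t, h s with hP
  have hPac : AbsolutelyContinuousOnInterval P 0 T := by
    have h1 := hhi.absolutelyContinuousOnInterval_intervalIntegral (c := 0) (by simp)
    have h2 : AbsolutelyContinuousOnInterval (fun _ : ℝ => a) 0 T :=
      contDiffOn_const.absolutelyContinuousOnInterval
    exact h2.add h1
  have hPd : ∀ᵐ x, x ∈ Ioo 0 T → deriv P x = h x := by
    filter_upwards [hhi.ae_hasDerivAt_integral] with x hx hxT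
    have := hx (by rw [uIcc_of_le hT.le]; exact Ioo_subset_Icc_self hxT) 0 (by simp)
    exact (this.const_add a).deriv
  have hP0 : P 0 = a := by simp [hP]
  rw [ae_restrict_iff' measurableSet_Ioo] at hfP ⊢
  filter_upwards [hfP] with t ht htT
  have hsub : uIcc 0 t ⊆ uIcc 0 T := by
    rw [uIcc_of_le hT.le, uIcc_of_le htT.1.le]; exact Icc_subset_Icc_right htT.2.le
  have h1 := (hPac.mono hsub).integral_deriv_mul_eq_sub (hPac.mono hsub)
  rw [hP0, intervalIntegral.integral_of_le htT.1.le, integral_Ioc_eq_integral_Ioo] at h1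
  have h2 : ∫ s in Ioo 0 t, (deriv P s * P s + P s * deriv P s) = ∫ s in Ioo 0 t, 2 * (h s * f s) := by
    refine setIntegral_congr_ae measurableSet_Ioo ?_
    filter_upwards [hfP, hPd] with s h1 h2 hst
    have hsT : s ∈ Ioo 0 T := ⟨hst.1, hst.2.trans htT.2⟩
    rw [h2 hsT, h1 hsT]
    ring
  rw [h2, integral_const_mul] at h1
  rw [ht htT, h1]
  ring

/-! ### The Sobolev inequality for weak gradients in `L²(ℝ³)` -/

theorem norm_le_sum_apply_unitVec (L : E3 →L[ℝ] ℝ) : ‖L‖ ≤ ∑ i, ‖L (unitVec i)‖ := by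
  refine L.opNorm_le_bound (Finset.sum_nonneg fun _ _ => norm_nonneg _) fun z => ?_
  have hz : z = ∑ i, z i • unitVec i := by
    ext j
    simp [unitVec, Finset.sum_apply, Pi.single_apply]
  conv_lhs => rw [hz]
  rw [map_sum, Finset.sum_mul]
  refine (norm_sum_le _ _).trans (Finset.sum_le_sum fun i _ => ?_)
  rw [map_smul, smul_eq_mul, norm_mul, mul_comm]
  gcongr
  exact PiLp.norm_apply_le z i

/-- The Gagliardo–Nirenberg–Sobolev inequality in dimension three, where `1/6 = 1/2 - 1/3`. -/
theorem exists_sobolev_const_smooth : ∃ C : ℝ≥0, ∀ w : E3 → ℝ, ContDiff ℝ 1 w →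
    HasCompactSupport w → eLpNorm w 6 volume ≤ C * ∑ i, eLpNorm (pd i w) 2 volume := by
  refine ⟨SNormLESNormFDerivOfEqConst ℝ (volume : Measure E3) 2, fun w hw hc => ?_⟩
  have h := eLpNorm_le_eLpNorm_fderiv_of_eq (volume : Measure E3) hw hc (p := 2) (p' := 6)
    (by norm_num) (by simp) (by simp; norm_num)
  refine (by simpa using h : eLpNorm w 6 volume ≤ _).trans ?_
  gcongr
  have hd : Continuous (fderiv ℝ w) := hw.continuous_fderiv (by simp)
  calc eLpNorm (fderiv ℝ w) 2 volume ≤ eLpNorm (fun x => ∑ i, ‖pd i w x‖) 2 volume :=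
        eLpNorm_mono fun x => by
          rw [Real.norm_of_nonneg (Finset.sum_nonneg fun _ _ => norm_nonneg _)]
          exact norm_le_sum_apply_unitVec _
    _ ≤ ∑ i, eLpNorm (fun x => ‖pd i w x‖) 2 volume := by
        have := eLpNorm_sum_le (μ := (volume : Measure E3)) (p := 2) (s := Finset.univ)
          (f := fun i x => ‖pd i w x‖) (fun i _ => by
            have : Continuous fun x => ‖pd i w x‖ := by unfold pd; fun_prop
            exact this.aestronglyMeasurable) one_le_two
        refine le_trans (le_of_eq ?_) this
        congr 1
    _ = ∑ i, eLpNorm (pd i w) 2 volume := by simp only [eLpNorm_norm]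

/-- A smooth cutoff equal to `1` on the unit ball. -/
def cutoff : ContDiffBump (0 : E3) := ⟨1, 2, one_pos, one_lt_two⟩

theorem isTest_cutoff : IsTest univ (cutoff : E3 → ℝ) :=
  ⟨cutoff.contDiff, cutoff.hasCompactSupport, subset_univ _⟩

/-- The cutoff at scale `n + 1`. -/
def cutoffAt (n : ℕ) (x : E3) : ℝ := cutoff ((n + 1 : ℝ)⁻¹ • x)

theorem isTest_cutoffAt (n : ℕ) : IsTest univ (cutoffAt n) := by
  refine ⟨isTest_cutoff.1.comp (contDiff_const_smul _), ?_, subset_univ _⟩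
  exact isTest_cutoff.2.1.comp_smul (by positivity)

theorem pd_cutoffAt (n : ℕ) (i : Fin 3) (x : E3) :
    pd i (cutoffAt n) x = (n + 1 : ℝ)⁻¹ * pd i cutoff ((n + 1 : ℝ)⁻¹ • x) := by
  have h1 : HasFDerivAt (fun x : E3 => (n + 1 : ℝ)⁻¹ • x)
      ((n + 1 : ℝ)⁻¹ • ContinuousLinearMap.id ℝ E3) x :=
    ((n + 1 : ℝ)⁻¹ • ContinuousLinearMap.id ℝ E3).hasFDerivAt
  have h2 := ((isTest_cutoff.1.differentiable (by simp)) ((n + 1 : ℝ)⁻¹ • x)).hasFDerivAt.comp x h1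
  have h3 : HasFDerivAt (cutoffAt n) _ x := h2
  simp [pd, h3.fderiv]

theorem tendsto_cutoffAt (x : E3) : Tendsto (fun n => cutoffAt n x) atTop (𝓝 1) := by
  have h1 : Tendsto (fun n : ℕ => (n + 1 : ℝ)⁻¹ • x) atTop (𝓝 ((0 : ℝ) • x)) := by
    refine Tendsto.smul_const ?_ x
    simpa using tendsto_one_div_add_atTop_nhds_zero_nat (𝕜 := ℝ)
  rw [zero_smul] at h1
  have h2 := (cutoff.continuous.tendsto 0).comp h1
  have h3 : cutoff (0 : E3) = 1 := cutoff.one_of_mem_closedBall (by simp [cutoff])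
  rw [h3] at h2
  exact h2

theorem exists_pd_cutoffAt_bound : ∃ c : ℝ≥0, ∀ n i x, ‖pd i (cutoffAt n) x‖ ≤ c * (n + 1 : ℝ)⁻¹ := by
  have h : ∀ i : Fin 3, ∃ C, ∀ x, ‖pd i cutoff x‖ ≤ C := fun i =>
    (isTest_cutoff.pd i).2.1.exists_bound_of_continuous (isTest_cutoff.pd i).continuous
  choose C hC using h
  refine ⟨∑ i, ‖C i‖₊, fun n i x => ?_⟩
  rw [pd_cutoffAt, norm_mul, mul_comm, Real.norm_of_nonneg (by positivity : (0:ℝ) ≤ (n + 1 : ℝ)⁻¹)]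
  gcongr
  push_cast
  refine ((hC i _).trans (Real.le_norm_self _)).trans ?_
  exact Finset.single_le_sum (f := fun i => ‖C i‖) (fun _ _ => norm_nonneg _) (Finset.mem_univ i)

theorem cutoffAt_norm_le (n : ℕ) (x : E3) : ‖cutoffAt n x‖ ≤ 1 := by
  rw [cutoffAt, Real.norm_of_nonneg (cutoff.nonneg' _)]
  exact cutoff.le_one

/-- Mollify, then cut off at scale `n + 1`. Differentiating the cutoff costs `c/(n+1)` times the
`L²` norm of `v`, which disappears in the limit; Fatou's lemma passes to `v` on the left. -/
theorem exists_sobolev_const : ∃ C : ℝ≥0, ∀ (v : E3 → ℝ) (g : Fin 3 → E3 → ℝ), MemLp v 2 →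
    (∀ i, MemLp (g i) 2) → (∀ i, IsWeakPartial i v (g i)) →
    eLpNorm v 6 volume ≤ C * ∑ i, eLpNorm (g i) 2 volume := by
  obtain ⟨C, hC⟩ := exists_sobolev_const_smooth
  obtain ⟨c, hc⟩ := exists_pd_cutoffAt_bound
  refine ⟨C, ?_⟩
  -- Young's inequality above asks for Borel functions; general `v` and `g` are reduced to Borel
  -- representatives afterwards.
  have key : ∀ (v : E3 → ℝ) (g : Fin 3 → E3 → ℝ), Measurable v → (∀ i, Measurable (g i)) →
      MemLp v 2 → (∀ i, MemLp (g i) 2) → (∀ i, IsWeakPartial i v (g i)) →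
      eLpNorm v 6 volume ≤ C * ∑ i, eLpNorm (g i) 2 volume := by
    intro v g hvm hgm hv hg hw
    have hvl := hv.locallyIntegrable one_le_two
    have hgl := fun i => (hg i).locallyIntegrable one_le_two
    have h2 : (2 : ℝ≥0∞) ≠ ∞ := by simp
    let V : ℕ → E3 → ℝ := fun n => moll n ⋆[ContinuousLinearMap.lsmul ℝ ℝ] v
    have hV : ∀ n, ContDiff ℝ ((⊤ : ℕ∞) : WithTop ℕ∞) (V n) := fun n => contDiff_convolution (isTest_moll n) hvl
    have hVpd : ∀ n i, pd i (V n) = moll n ⋆[ContinuousLinearMap.lsmul ℝ ℝ] (g i) := fun n i => by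
      rw [pd_convolution (isTest_moll n) hvl, pd_convolution_of_isWeakPartial (isTest_moll n) (hw i)]
    let w : ℕ → E3 → ℝ := fun n x => cutoffAt n x * V n x
    have hwd : ∀ n, ContDiff ℝ ((⊤ : ℕ∞) : WithTop ℕ∞) (w n) := fun n => (isTest_cutoffAt n).1.mul (hV n)
    have hpdw : ∀ n i x, pd i (w n) x = cutoffAt n x * pd i (V n) x + pd i (cutoffAt n) x * V n x := by
      intro n i x
      have h1 := ((isTest_cutoffAt n).1.differentiable (by simp) x).hasFDerivAt.mul
        ((hV n).differentiable (by simp) x).hasFDerivAt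
      have h3 : HasFDerivAt (w n) _ x := h1
      simp [pd, h3.fderiv]
      ring
    have hb : ∀ n i, eLpNorm (pd i (w n)) 2 volume
        ≤ eLpNorm (g i) 2 volume + ENNReal.ofReal (c * (n + 1 : ℝ)⁻¹) * eLpNorm v 2 volume := by
      intro n i
      have e : pd i (w n) = (fun x => cutoffAt n x * pd i (V n) x)
          + fun x => pd i (cutoffAt n) x * V n x := funext fun x => hpdw n i x
      have m1 : Continuous (cutoffAt n) := (isTest_cutoffAt n).continuous
      have m2 : Continuous (pd i (cutoffAt n)) := ((isTest_cutoffAt n).pd i).continuous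
      have m3 : Continuous (V n) := (hV n).continuous
      have m4 : Continuous (pd i (V n)) := by
        rw [hVpd]; exact (contDiff_convolution (isTest_moll n) (hgl i)).continuous
      rw [e]
      refine (eLpNorm_add_le (m1.mul m4).aestronglyMeasurable (m2.mul m3).aestronglyMeasurable
        one_le_two).trans (add_le_add ?_ ?_)
      · calc eLpNorm (fun x => cutoffAt n x * pd i (V n) x) 2 volume
            ≤ eLpNorm (pd i (V n)) 2 volume := eLpNorm_mono fun x => by
              rw [norm_mul]
              exact mul_le_of_le_one_left (norm_nonneg _) (cutoffAt_norm_le n x)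
          _ ≤ _ := by
              rw [hVpd]
              exact eLpNorm_moll_convolution_le one_le_two h2 n (hgm i)
      · refine (eLpNorm_le_mul_eLpNorm_of_ae_le_mul (g := V n) (c := c * (n + 1 : ℝ)⁻¹) (Eventually.of_forall fun x => ?_) 2).trans ?_
        · rw [Pi.mul_apply, norm_mul]
          gcongr
          exact hc n i x
        · gcongr
          exact eLpNorm_moll_convolution_le one_le_two h2 n hvm
    have hlim : ∀ᵐ x, Tendsto (fun n => w n x) atTop (𝓝 (v x)) := by
      filter_upwards [ae_tendsto_moll_convolution hvl] with x hx
      simpa using (tendsto_cutoffAt x).mul hx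
    have h1 : eLpNorm v 6 volume ≤ atTop.liminf fun n => eLpNorm (w n) 6 volume :=
      Lp.eLpNorm_lim_le_liminf_eLpNorm (fun n => (hwd n).continuous.aestronglyMeasurable) v hlim
    have h3 : Tendsto (fun n : ℕ => (C : ℝ≥0∞) * ∑ i, (eLpNorm (g i) 2 volume
        + ENNReal.ofReal (c * (n + 1 : ℝ)⁻¹) * eLpNorm v 2 volume)) atTop
        (𝓝 ((C : ℝ≥0∞) * ∑ i, (eLpNorm (g i) 2 volume + 0 * eLpNorm v 2 volume))) := by
      have h0 : Tendsto (fun n : ℕ => ENNReal.ofReal (c * (n + 1 : ℝ)⁻¹)) atTop (𝓝 0) := by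
        have := (tendsto_one_div_add_atTop_nhds_zero_nat (𝕜 := ℝ)).const_mul (c : ℝ)
        simpa using ENNReal.tendsto_ofReal this
      refine ENNReal.Tendsto.const_mul (tendsto_finsetSum _ fun i _ => tendsto_const_nhds.add ?_)
        (Or.inr (by simp))
      exact ENNReal.Tendsto.mul_const h0 (Or.inr hv.2.ne)
    simp only [zero_mul, add_zero] at h3
    calc eLpNorm v 6 volume ≤ atTop.liminf fun n => eLpNorm (w n) 6 volume := h1
      _ ≤ atTop.liminf fun n : ℕ => (C : ℝ≥0∞) * ∑ i, (eLpNorm (g i) 2 volume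
        + ENNReal.ofReal (c * (n + 1 : ℝ)⁻¹) * eLpNorm v 2 volume) := by
          refine liminf_le_liminf (Eventually.of_forall fun n => ?_)
          refine (hC (w n) ((hwd n).of_le (by simp)) (isTest_cutoffAt n).2.1.mul_right).trans ?_
          gcongr with i
          exact hb n i
      _ = _ := h3.liminf_eq
  intro v g hv hg hw
  have ev := hv.1.ae_eq_mk
  have eg := fun i => (hg i).1.ae_eq_mk
  rw [eLpNorm_congr_ae ev]
  simp only [eLpNorm_congr_ae (eg _)]
  refine key _ _ hv.1.stronglyMeasurable_mk.measurable
    (fun i => (hg i).1.stronglyMeasurable_mk.measurable) (hv.ae_eq ev) (fun i => (hg i).ae_eq (eg i))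
    fun i => ⟨(hv.ae_eq ev).locallyIntegrable one_le_two,
      ((hg i).ae_eq (eg i)).locallyIntegrable one_le_two, fun ψ hψ => ?_⟩
  have h1 : ∫ x, pd i ψ x * hv.1.mk v x = ∫ x, pd i ψ x * v x := by
    refine integral_congr_ae ?_
    filter_upwards [ev] with x hx
    rw [hx]
  have h2 : ∫ x, ψ x * (hg i).1.mk (g i) x = ∫ x, ψ x * g i x := by
    refine integral_congr_ae ?_
    filter_upwards [eg i] with x hx
    rw [hx]
  rw [h1, h2]
  exact (hw i).2.2 ψ hψ

/-! ### Local-in-space averages of a function on the slab -/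

/-- The kernel restricts `f` to a set of finite measure, where `L^p` is contained in `L¹`. This
holds for every `x`, not just almost every one, so the time argument can be run pointwise in space.
-/
theorem integrable_kernel_mul {T : ℝ} {p : ℝ≥0∞} (hp1 : 1 ≤ p) {k : E3 → ℝ} (hk : IsTest univ k)
    {f : ℝ × E3 → ℝ} (hf : MemLp f p (slab T)) (x : E3) :
    Integrable (fun z : ℝ × E3 => k (x - z.2) * f z) (slab T) := by
  have hk' := hk.reflect x
  set K := tsupport fun y => k (x - y) with hK
  have hKc : IsCompact K := hk'.2.1
  have hms : MeasurableSet ((univ : Set ℝ) ×ˢ K) := .prod .univ hKc.measurableSet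
  have hfin : slab T (univ ×ˢ K) < ∞ := by
    rw [slab, Measure.prod_prod]
    exact ENNReal.mul_lt_top (by simp) hKc.measure_lt_top
  have : IsFiniteMeasure ((slab T).restrict (univ ×ˢ K)) := ⟨by simpa using hfin⟩
  have h1 : IntegrableOn f (univ ×ˢ K) (slab T) := (hf.restrict _).integrable hp1
  obtain ⟨C, hC⟩ := hk'.2.1.exists_bound_of_continuous hk'.continuous
  have h2 : IntegrableOn (fun z : ℝ × E3 => k (x - z.2) * f z) (univ ×ˢ K) (slab T) :=
    h1.bdd_mul (c := C) (hk'.continuous.comp continuous_snd).aestronglyMeasurable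
      (Eventually.of_forall fun z => hC z.2)
  refine (integrableOn_iff_integrable_of_support_subset fun z hz => ?_).1 h2
  refine ⟨mem_univ _, subset_tsupport _ fun h0 => hz ?_⟩
  simp [h0]

theorem integrable_time_mul_kernel_mul {T : ℝ} {p : ℝ≥0∞} (hp1 : 1 ≤ p) {k : E3 → ℝ}
    (hk : IsTest univ k) {f : ℝ × E3 → ℝ} (hf : MemLp f p (slab T)) (x : E3) {θ : ℝ → ℝ}
    (hθ : Continuous θ) (hθc : HasCompactSupport θ) :
    Integrable (fun z : ℝ × E3 => θ z.1 * (k (x - z.2) * f z)) (slab T) := by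
  obtain ⟨C, hC⟩ := hθc.exists_bound_of_continuous hθ
  exact (integrable_kernel_mul hp1 hk hf x).bdd_mul (c := C)
    (hθ.comp continuous_fst).aestronglyMeasurable (Eventually.of_forall fun z => hC z.1)

theorem integral_time_mul_kernel_mul {T : ℝ} {p : ℝ≥0∞} (hp1 : 1 ≤ p) {k : E3 → ℝ}
    (hk : IsTest univ k) {f : ℝ × E3 → ℝ} (hf : MemLp f p (slab T)) (x : E3) {θ : ℝ → ℝ}
    (hθ : Continuous θ) (hθc : HasCompactSupport θ) :
    ∫ z : ℝ × E3, θ z.1 * (k (x - z.2) * f z) ∂slab T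
      = ∫ t in Ioo 0 T, θ t * sconv k f (t, x) := by
  have h := integrable_time_mul_kernel_mul hp1 hk hf x hθ hθc
  rw [slab] at h ⊢
  rw [integral_prod _ h]
  refine integral_congr_ae (Eventually.of_forall fun t => ?_)
  simp only [sconv_eq]
  rw [integral_const_mul]

theorem integrableOn_sconv {T : ℝ} {p : ℝ≥0∞} (hp1 : 1 ≤ p) {k : E3 → ℝ}
    (hk : IsTest univ k) {f : ℝ × E3 → ℝ} (hf : MemLp f p (slab T)) (x : E3) :
    IntegrableOn (fun t => sconv k f (t, x)) (Ioo 0 T) := by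
  have h := integrable_kernel_mul hp1 hk hf x
  rw [slab] at h
  simp only [sconv_eq]
  exact h.integral_prod_left

/-! ### Integrating a pointwise balance over space -/

theorem slab_restrict_prod {T t : ℝ} (ht : t ≤ T) :
    (slab T).restrict (Ioo 0 t ×ˢ univ) = slab t := by
  rw [slab_eq_restrict, slab_eq_restrict, Measure.restrict_restrict
    (measurableSet_Ioo.prod .univ)]
  congr 1
  rw [prod_inter_prod, univ_inter, inter_eq_left.2 (Ioo_subset_Ioo_right ht)]

theorem slab_mono {T t : ℝ} (ht : t ≤ T) : slab t ≤ slab T := by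
  rw [← slab_restrict_prod ht]
  exact Measure.restrict_le_self

/-- The null set of times in `H` depends on `x`. Fubini trades it for one null set of times outside
which the identity holds for almost every `x`, and the identity can then be integrated. -/
theorem ae_integral_sq_eq {T : ℝ} {f h : ℝ × E3 → ℝ} {a : E3 → ℝ} (hfm : Measurable f)
    (hhm : Measurable h) (ham : Measurable a) (ha : Integrable fun x => a x ^ 2)
    (hhf : Integrable (fun z => h z * f z) (slab T))
    (H : ∀ x, ∀ᵐ t ∂volume.restrict (Ioo 0 T),
      f (t, x) ^ 2 = a x ^ 2 + 2 * ∫ s in Ioo 0 t, h (s, x) * f (s, x)) :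
    ∀ᵐ t ∂volume.restrict (Ioo 0 T),
      ∫ x, f (t, x) ^ 2 = (∫ x, a x ^ 2) + 2 * ∫ z, h z * f z ∂slab t := by
  have hm : Measurable fun w : ℝ × E3 => ∫ s in Ioo 0 w.1, h (s, w.2) * f (s, w.2) := by
    -- The variable endpoint is moved into an indicator to obtain joint measurability in `(t, x)`.
    have h1 : StronglyMeasurable fun q : (ℝ × E3) × ℝ =>
        {q : (ℝ × E3) × ℝ | 0 < q.2 ∧ q.2 < q.1.1}.indicator
          (fun q => h (q.2, q.1.2) * f (q.2, q.1.2)) q := by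
      refine Measurable.stronglyMeasurable (Measurable.indicator (by fun_prop) ?_)
      exact (measurableSet_lt measurable_const measurable_snd).inter
        (measurableSet_lt measurable_snd (by fun_prop))
    have h2 := h1.integral_prod_right' (ν := volume)
    convert! h2.measurable using 1
    ext w
    rw [← integral_indicator measurableSet_Ioo]
    rfl
  have hcomm := (Measure.ae_ae_comm (μ := (volume : Measure E3)) (ν := volume.restrict (Ioo 0 T))
    (p := fun x t => f (t, x) ^ 2 = a x ^ 2 + 2 * ∫ s in Ioo 0 t, h (s, x) * f (s, x))
    (measurableSet_eq_fun (by fun_prop)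
      (((ham.comp measurable_fst).pow_const 2).add
        ((hm.comp measurable_swap).const_mul 2)))).1 (Eventually.of_forall H)
  filter_upwards [hcomm, ae_restrict_mem measurableSet_Ioo] with t ht htT
  have hi : Integrable (fun z => h z * f z) ((volume.restrict (Ioo 0 t)).prod volume) :=
    hhf.mono_measure (slab_mono htT.2.le)
  rw [integral_congr_ae ht, integral_add ha (hi.integral_prod_right.const_mul 2),
    integral_const_mul, slab, integral_prod_symm _ hi]

/-! ### The nonlinear term in coordinates -/

/-- The exponents of the `L⁴` theory: `L⁴ · L⁴ ⊆ L²`, `L⁴ · L² ⊆ L^{4/3}`, and `L^{4/3}` pairs with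
`L⁴`. -/
instance : ENNReal.HolderTriple 4 4 2 where
  inv_add_inv_eq_inv := by
    rw [← ENNReal.toReal_eq_toReal_iff' (by simp) (by simp),
      ENNReal.toReal_add (by simp) (by simp)]
    norm_num

instance : ENNReal.HolderTriple 4 2 (4 / 3) where
  inv_add_inv_eq_inv := by
    rw [← ENNReal.toReal_eq_toReal_iff' (by simp) (by
        rw [ne_eq, ENNReal.inv_eq_top]; exact (ENNReal.div_pos (by simp) (by simp)).ne'),
      ENNReal.toReal_add (by simp) (by simp)]
    simp
    norm_num

instance : ENNReal.HolderTriple (4 / 3) 4 1 where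
  inv_add_inv_eq_inv := by
    rw [ENNReal.inv_div (by simp) (by simp), ← ENNReal.toReal_eq_toReal_iff' (by finiteness) (by simp),
      ENNReal.toReal_add (by finiteness) (by simp)]
    simp
    norm_num

theorem one_le_four_div_three : (1 : ℝ≥0∞) ≤ 4 / 3 := by
  rw [ENNReal.le_div_iff_mul_le (by simp) (by simp)]
  norm_num

theorem four_div_three_ne_top : (4 / 3 : ℝ≥0∞) ≠ ∞ := by finiteness

/-- The `j`-th component of `(u · ∇) u + (1/2) (div u) u`, where `G i j = ∂ᵢuⱼ`. -/
def nl {X : Type*} (u : Fin 3 → X → ℝ) (G : Fin 3 → Fin 3 → X → ℝ) (j : Fin 3) (z : X) : ℝ :=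
  ∑ i, (u i z * G i j z + 1 / 2 * (u j z * G i i z))

theorem memLp_nl {X : Type*} [MeasurableSpace X] {μ : Measure X} {u : Fin 3 → X → ℝ}
    {G : Fin 3 → Fin 3 → X → ℝ} (hu : ∀ j, MemLp (u j) 4 μ) (hG : ∀ i j, MemLp (G i j) 2 μ)
    (j : Fin 3) : MemLp (nl u G j) (4 / 3) μ := by
  refine memLp_finsetSum _ fun i _ => ?_
  exact ((hG i j).mul' (hu i)).add (((hG i i).mul' (hu j)).const_mul _)

/-- The integrand is half the sum over `i, j` of `wᵢ ∂ᵢ(wⱼ²) + wⱼ² ∂ᵢwᵢ`, a divergence. The factor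
`1/2` in `nl` is exactly what makes this work without `div w = 0`. The bounds in `L²` and `L⁴` make
every product integrable, so there is no contribution at infinity. -/
theorem integral_sum_nl_mul_eq_zero {w : Fin 3 → E3 → ℝ}
    (hw : ∀ j, ContDiff ℝ ((⊤ : ℕ∞) : WithTop ℕ∞) (w j)) (h2 : ∀ j, MemLp (w j) 2)
    (h4 : ∀ j, MemLp (w j) 4) (hd : ∀ i j, MemLp (pd i (w j)) 2) :
    ∫ x, ∑ j, nl w (fun i j => pd i (w j)) j x * w j x = 0 := by
  have m4 : ∀ i j, MemLp (fun x => w i x * w j x) 2 := fun i j => (h4 j).mul' (h4 i)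
  have iA : ∀ i j, Integrable fun x => w i x * (2 * (w j x * pd i (w j) x)) := fun i j => by
    refine (((m4 i j).integrable_mul (hd i j)).const_mul 2).congr (Eventually.of_forall fun x => ?_)
    simp only [Pi.mul_apply]
    ring
  have iB : ∀ i j, Integrable fun x => pd i (w i) x * (w j x * w j x) := fun i j =>
    (hd i i).integrable_mul (m4 j j)
  have hAB : ∀ i j, ∫ x, w i x * (2 * (w j x * pd i (w j) x))
      = -∫ x, pd i (w i) x * (w j x * w j x) := by
    intro i j
    have hpd : ∀ x, fderiv ℝ (fun x => w j x * w j x) x (unitVec i)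
        = 2 * (w j x * pd i (w j) x) := by
      intro x
      have h := ((hw j).differentiable (by simp) x).hasFDerivAt
      have h3 : HasFDerivAt (fun x => w j x * w j x) _ x := h.mul h
      simp [pd, h3.fderiv]
      ring
    have key := integral_mul_fderiv_eq_neg_fderiv_mul_of_integrable (μ := (volume : Measure E3))
      (f := w i) (g := fun x => w j x * w j x) (v := unitVec i) (iB i j)
      (by simpa only [hpd] using iA i j) ((h2 i).integrable_mul (m4 j j))
      (fun x _ => (hw i).differentiable (by simp) x)
      (fun x _ => ((hw j).mul (hw j)).differentiable (by simp) x)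
    simp only [hpd] at key
    exact key
  have iAB : ∀ i j, Integrable fun x => 1 / 2 * (w i x * (2 * (w j x * pd i (w j) x)))
      + 1 / 2 * (pd i (w i) x * (w j x * w j x)) := fun i j =>
    ((iA i j).const_mul _).add ((iB i j).const_mul _)
  have e : ∀ x, ∑ j, nl w (fun i j => pd i (w j)) j x * w j x
      = ∑ j, ∑ i, (1 / 2 * (w i x * (2 * (w j x * pd i (w j) x)))
        + 1 / 2 * (pd i (w i) x * (w j x * w j x))) := by
    intro x
    refine Finset.sum_congr rfl fun j _ => ?_
    rw [nl, Finset.sum_mul]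
    refine Finset.sum_congr rfl fun i _ => ?_
    ring
  simp only [e]
  rw [integral_finsetSum _ fun j _ => integrable_finsetSum _ fun i _ => iAB i j]
  refine Finset.sum_eq_zero fun j _ => ?_
  rw [integral_finsetSum _ fun i _ => iAB i j]
  refine Finset.sum_eq_zero fun i _ => ?_
  rw [integral_add ((iA i j).const_mul _) ((iB i j).const_mul _), integral_const_mul,
    integral_const_mul, hAB]
  ring

theorem eLpNorm_mul_le_mul_eLpNorm {X : Type*} [MeasurableSpace X] {μ : Measure X} {p q r : ℝ≥0∞}
    [ENNReal.HolderTriple p q r] {f g : X → ℝ} (hf : AEStronglyMeasurable f μ)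
    (hg : AEStronglyMeasurable g μ) :
    eLpNorm (fun z => f z * g z) r μ ≤ eLpNorm f p μ * eLpNorm g q μ := by
  simpa using eLpNorm_le_eLpNorm_mul_eLpNorm_of_nnnorm (r := r) hf hg (fun a b => a * b) 1
    (Eventually.of_forall fun z => by simp)

/-- Write `aₙbₙ - ab = (aₙ - a)bₙ + a(bₙ - b)` and apply Hölder to each term. For mollified
functions the bound `hB` is Young's inequality. -/
theorem tendsto_eLpNorm_mul_sub {X : Type*} [MeasurableSpace X] {μ : Measure X} {p q r : ℝ≥0∞}
    [ENNReal.HolderTriple p q r] (hr : 1 ≤ r) {a : ℕ → X → ℝ} {b : ℕ → X → ℝ} {a' b' : X → ℝ}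
    (ham : ∀ n, AEStronglyMeasurable (a n) μ) (hbm : ∀ n, AEStronglyMeasurable (b n) μ)
    (ha' : MemLp a' p μ) (hb' : MemLp b' q μ) (hB : ∀ n, eLpNorm (b n) q μ ≤ eLpNorm b' q μ)
    (ha : Tendsto (fun n => eLpNorm (fun z => a n z - a' z) p μ) atTop (𝓝 0))
    (hb : Tendsto (fun n => eLpNorm (fun z => b n z - b' z) q μ) atTop (𝓝 0)) :
    Tendsto (fun n => eLpNorm (fun z => a n z * b n z - a' z * b' z) r μ) atTop (𝓝 0) := by
  have h1 : Tendsto (fun n => eLpNorm (fun z => a n z - a' z) p μ * eLpNorm b' q μ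
      + eLpNorm a' p μ * eLpNorm (fun z => b n z - b' z) q μ) atTop (𝓝 0) := by
    have := (ENNReal.Tendsto.mul_const ha (Or.inr hb'.2.ne)).add
      (ENNReal.Tendsto.const_mul (a := eLpNorm a' p μ) hb (Or.inr ha'.2.ne))
    simpa using this
  refine tendsto_of_tendsto_of_tendsto_of_le_of_le tendsto_const_nhds h1 (fun _ => zero_le)
    fun n => ?_
  have e : (fun z => a n z * b n z - a' z * b' z)
      = (fun z => (a n z - a' z) * b n z) + fun z => a' z * (b n z - b' z) := by
    ext z
    simp only [Pi.add_apply]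
    ring
  have m1 := (ham n).sub ha'.1
  have m2 := (hbm n).sub hb'.1
  change eLpNorm (fun z => a n z * b n z - a' z * b' z) r μ ≤ _
  rw [e]
  refine (eLpNorm_add_le (m1.mul (hbm n)) (ha'.1.mul m2) hr).trans (add_le_add ?_ ?_)
  · exact (eLpNorm_mul_le_mul_eLpNorm (p := p) (q := q) m1 (hbm n)).trans
      (mul_le_mul_right (hB n) _)
  · exact eLpNorm_mul_le_mul_eLpNorm (p := p) (q := q) ha'.1 m2

theorem tendsto_eLpNorm_nl_sub {X : Type*} [MeasurableSpace X] {μ : Measure X}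
    {u' : ℕ → Fin 3 → X → ℝ} {G' : ℕ → Fin 3 → Fin 3 → X → ℝ} {u : Fin 3 → X → ℝ}
    {G : Fin 3 → Fin 3 → X → ℝ} (hu : ∀ j, MemLp (u j) 4 μ) (hG : ∀ i j, MemLp (G i j) 2 μ)
    (hu'm : ∀ n j, AEStronglyMeasurable (u' n j) μ)
    (hG'm : ∀ n i j, AEStronglyMeasurable (G' n i j) μ)
    (hG' : ∀ n i j, eLpNorm (G' n i j) 2 μ ≤ eLpNorm (G i j) 2 μ)
    (hul : ∀ j, Tendsto (fun n => eLpNorm (fun z => u' n j z - u j z) 4 μ) atTop (𝓝 0))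
    (hGl : ∀ i j, Tendsto (fun n => eLpNorm (fun z => G' n i j z - G i j z) 2 μ) atTop (𝓝 0))
    (j : Fin 3) :
    Tendsto (fun n => eLpNorm (fun z => nl (u' n) (G' n) j z - nl u G j z) (4 / 3) μ)
      atTop (𝓝 0) := by
  have h1 := fun i => tendsto_eLpNorm_mul_sub one_le_four_div_three (fun n => hu'm n i)
    (fun n => hG'm n i j) (hu i) (hG i j) (fun n => hG' n i j) (hul i) (hGl i j)
  have h2 := fun i => tendsto_eLpNorm_mul_sub one_le_four_div_three (fun n => hu'm n j)
    (fun n => hG'm n i i) (hu j) (hG i i) (fun n => hG' n i i) (hul j) (hGl i i)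
  have h3 := tendsto_finsetSum (Finset.univ : Finset (Fin 3)) fun i _ =>
    (h1 i).add (ENNReal.Tendsto.const_mul (a := ‖(1 / 2 : ℝ)‖ₑ) (h2 i) (Or.inr enorm_ne_top))
  simp only [mul_zero, add_zero, Finset.sum_const_zero] at h3
  refine tendsto_of_tendsto_of_tendsto_of_le_of_le tendsto_const_nhds h3 (fun _ => zero_le)
    fun n => ?_
  have mA : ∀ i, AEStronglyMeasurable (fun z => u' n i z * G' n i j z - u i z * G i j z) μ :=
    fun i => ((hu'm n i).mul (hG'm n i j)).sub ((hu i).1.mul (hG i j).1)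
  have mB : ∀ i, AEStronglyMeasurable (fun z => u' n j z * G' n i i z - u j z * G i i z) μ :=
    fun i => ((hu'm n j).mul (hG'm n i i)).sub ((hu j).1.mul (hG i i).1)
  have e : (fun z => nl (u' n) (G' n) j z - nl u G j z)
      = ∑ i, ((fun z => u' n i z * G' n i j z - u i z * G i j z)
        + (1 / 2 : ℝ) • fun z => u' n j z * G' n i i z - u j z * G i i z) := by
    ext z
    simp only [nl, Finset.sum_apply, Pi.add_apply, Pi.smul_apply, smul_eq_mul,
      ← Finset.sum_sub_distrib]
    refine Finset.sum_congr rfl fun i _ => ?_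
    ring
  change eLpNorm (fun z => nl (u' n) (G' n) j z - nl u G j z) (4 / 3) μ ≤ _
  rw [e]
  refine (eLpNorm_sum_le (fun i _ => (mA i).add ((mB i).const_smul _))
    one_le_four_div_three).trans (Finset.sum_le_sum fun i _ => ?_)
  refine (eLpNorm_add_le (mA i) ((mB i).const_smul _) one_le_four_div_three).trans ?_
  rw [eLpNorm_const_smul]

/-! ### The mollified energy balance at a fixed time -/

/-- By parts, the pressure term becomes the product of mollified divergence and pressure, which the
last term on the left cancels, and the viscous term becomes minus a square. -/
theorem integral_mollified_balance {k : E3 → ℝ} (hk : IsTest univ k) {U : Fin 3 → E3 → ℝ}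
    {G : Fin 3 → Fin 3 → E3 → ℝ} {P : E3 → ℝ} (hUm : ∀ j, Measurable (U j))
    (hGm : ∀ i j, Measurable (G i j)) (hPm : Measurable P) (hU2 : ∀ j, MemLp (U j) 2)
    (hU4 : ∀ j, MemLp (U j) 4) (hG : ∀ i j, MemLp (G i j) 2) (hP : MemLp P 2)
    (hw : ∀ i j, IsWeakPartial i (U j) (G i j)) :
    ∫ x, ((∑ j, (-(pd j k ⋆[ContinuousLinearMap.lsmul ℝ ℝ] P) x
        + (∑ i, (pd i k ⋆[ContinuousLinearMap.lsmul ℝ ℝ] G i j) x)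
        - (k ⋆[ContinuousLinearMap.lsmul ℝ ℝ] nl U G j) x)
          * (k ⋆[ContinuousLinearMap.lsmul ℝ ℝ] U j) x)
        - (∑ i, (pd i k ⋆[ContinuousLinearMap.lsmul ℝ ℝ] U i) x)
          * (k ⋆[ContinuousLinearMap.lsmul ℝ ℝ] P) x)
      = ∫ x, (-(∑ j, ∑ i, (k ⋆[ContinuousLinearMap.lsmul ℝ ℝ] G i j) x ^ 2)
        - ∑ j, ((k ⋆[ContinuousLinearMap.lsmul ℝ ℝ] nl U G j) x
          - nl (fun j => k ⋆[ContinuousLinearMap.lsmul ℝ ℝ] U j)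
            (fun i j => k ⋆[ContinuousLinearMap.lsmul ℝ ℝ] G i j) j x)
          * (k ⋆[ContinuousLinearMap.lsmul ℝ ℝ] U j) x) := by
  have t2 : (2 : ℝ≥0∞) ≠ ∞ := by simp
  have t4 : (4 : ℝ≥0∞) ≠ ∞ := by simp
  have o4 : (1 : ℝ≥0∞) ≤ 4 := by norm_num
  have hUl := fun j => (hU2 j).locallyIntegrable one_le_two
  have hNm : ∀ j, Measurable (nl U G j) := fun j => by
    unfold nl
    fun_prop
  set W : Fin 3 → E3 → ℝ := fun j => k ⋆[ContinuousLinearMap.lsmul ℝ ℝ] U j with hW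
  set D : Fin 3 → Fin 3 → E3 → ℝ := fun i j => k ⋆[ContinuousLinearMap.lsmul ℝ ℝ] G i j with hD
  set N : Fin 3 → E3 → ℝ := fun j => k ⋆[ContinuousLinearMap.lsmul ℝ ℝ] nl U G j with hN
  set Q : E3 → ℝ := k ⋆[ContinuousLinearMap.lsmul ℝ ℝ] P with hQ
  set A : Fin 3 → E3 → ℝ := fun j => pd j k ⋆[ContinuousLinearMap.lsmul ℝ ℝ] P with hA
  set B : Fin 3 → Fin 3 → E3 → ℝ := fun i j => pd i k ⋆[ContinuousLinearMap.lsmul ℝ ℝ] G i j with hB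
  have hDU : ∀ i j, pd i k ⋆[ContinuousLinearMap.lsmul ℝ ℝ] U j = D i j := fun i j =>
    pd_convolution_of_isWeakPartial hk (hw i j)
  have hDW : ∀ i j, pd i (W j) = D i j := fun i j => by
    rw [hW, pd_convolution hk (hUl j), hDU]
  have mW2 : ∀ j, MemLp (W j) 2 := fun j => memLp_convolution one_le_two t2 hk (hUm j) (hU2 j)
  have mW4 : ∀ j, MemLp (W j) 4 := fun j => memLp_convolution o4 t4 hk (hUm j) (hU4 j)
  have mD : ∀ i j, MemLp (D i j) 2 := fun i j => memLp_convolution one_le_two t2 hk (hGm i j) (hG i j)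
  have mN : ∀ j, MemLp (N j) (4 / 3) := fun j =>
    memLp_convolution one_le_four_div_three four_div_three_ne_top hk (hNm j) (memLp_nl hU4 hG j)
  have mN' : ∀ j, MemLp (nl W D j) (4 / 3) := fun j => memLp_nl mW4 mD j
  have mQ : MemLp Q 2 := memLp_convolution one_le_two t2 hk hPm hP
  have mA : ∀ j, MemLp (A j) 2 := fun j => memLp_convolution one_le_two t2 (hk.pd j) hPm hP
  have mB : ∀ i j, MemLp (B i j) 2 := fun i j =>
    memLp_convolution one_le_two t2 (hk.pd i) (hGm i j) (hG i j)
  have iA : ∀ j, Integrable fun x => A j x * W j x := fun j => (mA j).integrable_mul (mW2 j)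
  have iB : ∀ i j, Integrable fun x => B i j x * W j x := fun i j => (mB i j).integrable_mul (mW2 j)
  have iN : ∀ j, Integrable fun x => N j x * W j x := fun j =>
    memLp_one_iff_integrable.1 ((mW4 j).mul' (mN j))
  have iN' : ∀ j, Integrable fun x => nl W D j x * W j x := fun j =>
    memLp_one_iff_integrable.1 ((mW4 j).mul' (mN' j))
  have iDQ : ∀ i, Integrable fun x => D i i x * Q x := fun i => (mD i i).integrable_mul mQ
  have iDD : ∀ i j, Integrable fun x => D i j x ^ 2 := fun i j => (mD i j).integrable_sq
  have eA : ∀ j, ∫ x, A j x * W j x = -∫ x, D j j x * Q x := fun j => by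
    have := integral_pd_convolution_mul hk hPm (hUm j) hP (hU2 j) j
    rw [hDU] at this
    rw [this]
    simp only [hQ, mul_comm]
  have eB : ∀ i j, ∫ x, B i j x * W j x = -∫ x, D i j x ^ 2 := fun i j => by
    have := integral_pd_convolution_mul hk (hGm i j) (hUm j) (hG i j) (hU2 j) i
    rw [hDU] at this
    rw [this]
    simp only [hD, sq]
  -- As this sum is zero, it can be inserted freely; it turns the nonlinear term into a commutator.
  have eN : ∑ j, ∫ x, nl W D j x * W j x = 0 := by
    have := integral_sum_nl_mul_eq_zero (w := W) (fun j => contDiff_convolution hk (hUl j)) mW2 mW4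
      (fun i j => by rw [hDW]; exact mD i j)
    simp only [hDW] at this
    rwa [integral_finsetSum _ fun j _ => iN' j] at this
  have iL : ∀ j, Integrable fun x => -(A j x * W j x) + (∑ i, B i j x * W j x) - N j x * W j x :=
    fun j => ((iA j).neg.add (integrable_finsetSum _ fun i _ => iB i j)).sub (iN j)
  have L : ∫ x, ((∑ j, (-A j x + (∑ i, B i j x) - N j x) * W j x) - (∑ i, D i i x) * Q x)
      = (∑ j, (-(∫ x, A j x * W j x) + (∑ i, ∫ x, B i j x * W j x) - ∫ x, N j x * W j x))
        - ∑ i, ∫ x, D i i x * Q x := by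
    have e : ∀ x, ((∑ j, (-A j x + (∑ i, B i j x) - N j x) * W j x) - (∑ i, D i i x) * Q x)
        = (∑ j, (-(A j x * W j x) + (∑ i, B i j x * W j x) - N j x * W j x))
          - ∑ i, D i i x * Q x := fun x => by
      simp only [sub_mul, add_mul, neg_mul, Finset.sum_mul]
    simp only [e]
    rw [integral_sub (integrable_finsetSum _ fun j _ => iL j)
      (integrable_finsetSum _ fun i _ => iDQ i), integral_finsetSum _ fun j _ => iL j,
      integral_finsetSum _ fun i _ => iDQ i]
    congr 1
    refine Finset.sum_congr rfl fun j _ => ?_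
    have i1 : Integrable fun x => -(A j x * W j x) := (iA j).neg
    have i2 : Integrable fun x => ∑ i, B i j x * W j x := integrable_finsetSum _ fun i _ => iB i j
    rw [integral_sub (by exact i1.add i2) (iN j), integral_add i1 i2, integral_neg,
      integral_finsetSum _ fun i _ => iB i j]
  have R : ∫ x, (-(∑ j, ∑ i, D i j x ^ 2) - ∑ j, (N j x - nl W D j x) * W j x)
      = -(∑ j, ∑ i, ∫ x, D i j x ^ 2) - ∑ j, ((∫ x, N j x * W j x) - ∫ x, nl W D j x * W j x) := by
    simp only [sub_mul]
    have i1 : Integrable fun x => -(∑ j, ∑ i, D i j x ^ 2) :=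
      (integrable_finsetSum _ fun j _ => integrable_finsetSum _ fun i _ => iDD i j).neg
    have i2 : ∀ j, Integrable fun x => N j x * W j x - nl W D j x * W j x :=
      fun j => (iN j).sub (iN' j)
    rw [integral_sub i1 (integrable_finsetSum _ fun j _ => i2 j), integral_neg,
      integral_finsetSum _ fun j _ => integrable_finsetSum _ fun i _ => iDD i j,
      integral_finsetSum _ fun j _ => i2 j]
    congr 1
    · congr 1
      exact Finset.sum_congr rfl fun j _ => integral_finsetSum _ fun i _ => iDD i j
    · exact Finset.sum_congr rfl fun j _ => integral_sub (iN j) (iN' j)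
  simp only [hDU]
  refine L.trans (Eq.trans ?_ R.symm)
  simp only [eA, eB, Finset.sum_sub_distrib, Finset.sum_add_distrib, Finset.sum_neg_distrib, eN]
  ring

/-! ### Weak solutions in coordinates, with Borel representatives -/

/-- The weak formulation in coordinates, tested with products `θ(t) ψ(x)`, for a solution
whose velocity lies in `L⁴`. Here `G i j = ∂ᵢuⱼ`. -/
structure CoordSolution (T ε : ℝ) (u₀ : Fin 3 → E3 → ℝ) (p₀ : E3 → ℝ) (u : Fin 3 → ℝ × E3 → ℝ)
    (G : Fin 3 → Fin 3 → ℝ × E3 → ℝ) (p : ℝ × E3 → ℝ) : Prop where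
  u₀_meas : ∀ j, Measurable (u₀ j)
  p₀_meas : Measurable p₀
  u_meas : ∀ j, Measurable (u j)
  G_meas : ∀ i j, Measurable (G i j)
  p_meas : Measurable p
  u₀_mem : ∀ j, MemLp (u₀ j) 2
  p₀_mem : MemLp p₀ 2
  u_mem : ∀ j, MemLp (u j) 2 (slab T)
  u_mem_four : ∀ j, MemLp (u j) 4 (slab T)
  G_mem : ∀ i j, MemLp (G i j) 2 (slab T)
  p_mem : MemLp p 2 (slab T)
  grad : ∀ᵐ t ∂volume.restrict (Ioo 0 T), ∀ i j,
    IsWeakPartial i (fun x => u j (t, x)) (fun x => G i j (t, x))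
  momentum : ∀ (j : Fin 3) (θ : ℝ → ℝ) (ψ : E3 → ℝ), IsTest (Iio T) θ → IsTest univ ψ →
    ∫ z, (-(deriv θ z.1 * (ψ z.2 * u j z)) - θ z.1 * (pd j ψ z.2 * p z)
      + (∑ i, θ z.1 * (pd i ψ z.2 * G i j z)) + θ z.1 * (ψ z.2 * nl u G j z)) ∂slab T
      = θ 0 * ∫ x, ψ x * u₀ j x
  continuity : ∀ (θ : ℝ → ℝ) (ψ : E3 → ℝ), IsTest (Iio T) θ → IsTest univ ψ →
    ∫ z, (-(ε * (deriv θ z.1 * (ψ z.2 * p z))) - ∑ i, θ z.1 * (pd i ψ z.2 * u i z)) ∂slab T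
      = θ 0 * (ε * ∫ x, ψ x * p₀ x)

/-! ### The mollified equations and their energy balance. -/

namespace CoordSolution

variable {T ε : ℝ} {u₀ : Fin 3 → E3 → ℝ} {p₀ : E3 → ℝ} {u : Fin 3 → ℝ × E3 → ℝ}
  {G : Fin 3 → Fin 3 → ℝ × E3 → ℝ} {p : ℝ × E3 → ℝ}

theorem nl_meas (h : CoordSolution T ε u₀ p₀ u G p) (j : Fin 3) : Measurable (nl u G j) := by
  have h1 := h.u_meas
  have h2 := h.G_meas
  unfold nl
  fun_prop

theorem nl_mem (h : CoordSolution T ε u₀ p₀ u G p) (j : Fin 3) :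
    MemLp (nl u G j) (4 / 3) (slab T) := memLp_nl h.u_mem_four h.G_mem j

/-- The right-hand side of the mollified momentum equation. -/
def rhs (k : E3 → ℝ) (u : Fin 3 → ℝ × E3 → ℝ) (G : Fin 3 → Fin 3 → ℝ × E3 → ℝ) (p : ℝ × E3 → ℝ)
    (j : Fin 3) (z : ℝ × E3) : ℝ :=
  -sconv (pd j k) p z + (∑ i, sconv (pd i k) (G i j) z) - sconv k (nl u G j) z

/-- Test with `θ(t) k(x - y)` in the variables `(t, y)`: all space derivatives fall on the kernel,
and Fubini leaves a scalar equation in time at the fixed point `x`. -/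
theorem weak_deriv_u (h : CoordSolution T ε u₀ p₀ u G p) {k : E3 → ℝ} (hk : IsTest univ k)
    (j : Fin 3) (x : E3) (θ : ℝ → ℝ) (hθ : IsTest (Iio T) θ) :
    -∫ t in Ioo 0 T, deriv θ t * sconv k (u j) (t, x)
      = θ 0 * (k ⋆[ContinuousLinearMap.lsmul ℝ ℝ] u₀ j) x
        + ∫ t in Ioo 0 T, θ t * rhs k u G p j (t, x) := by
  have hθc := hθ.1.continuous
  have hθ'c : Continuous (deriv θ) := hθ.1.continuous_deriv (by simp)
  have hθ's : HasCompactSupport (deriv θ) := hθ.2.1.deriv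
  have key := h.momentum j θ _ hθ (hk.reflect x)
  simp only [pd_reflect hk, neg_mul, mul_neg, sub_neg_eq_add, Finset.sum_neg_distrib] at key
  rw [← convolution_lsmul_eq] at key
  have i1 := integrable_time_mul_kernel_mul one_le_two hk (h.u_mem j) x hθ'c hθ's
  have i2 := integrable_time_mul_kernel_mul one_le_two (hk.pd j) h.p_mem x hθc hθ.2.1
  have i3 := fun i => integrable_time_mul_kernel_mul one_le_two (hk.pd i) (h.G_mem i j) x hθc hθ.2.1
  have i4 := integrable_time_mul_kernel_mul one_le_four_div_three hk (h.nl_mem j) x hθc hθ.2.1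
  have e1 := integral_time_mul_kernel_mul one_le_two hk (h.u_mem j) x hθ'c hθ's
  have e2 := integral_time_mul_kernel_mul one_le_two (hk.pd j) h.p_mem x hθc hθ.2.1
  have e3 := fun i => integral_time_mul_kernel_mul one_le_two (hk.pd i) (h.G_mem i j) x hθc hθ.2.1
  have e4 := integral_time_mul_kernel_mul one_le_four_div_three hk (h.nl_mem j) x hθc hθ.2.1
  have i3' := integrable_finsetSum Finset.univ fun i _ => i3 i
  rw [integral_add (by exact (i1.neg.add i2).add i3'.neg) i4,
    integral_add (by exact i1.neg.add i2) (by exact i3'.neg), integral_add (by exact i1.neg) i2,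
    integral_neg, integral_neg, integral_finsetSum _ fun i _ => i3 i, e1, e2, e4] at key
  simp only [e3] at key
  obtain ⟨C, hC⟩ := hθ.2.1.exists_bound_of_continuous hθc
  have b : ∀ {f : ℝ → ℝ}, IntegrableOn f (Ioo 0 T) → IntegrableOn (fun t => θ t * f t) (Ioo 0 T) :=
    fun hf => hf.bdd_mul hθc.aestronglyMeasurable (Eventually.of_forall hC)
  have j2 := b (integrableOn_sconv one_le_two (hk.pd j) h.p_mem x)
  have j3 := fun i => b (integrableOn_sconv one_le_two (hk.pd i) (h.G_mem i j) x)
  have j4 := b (integrableOn_sconv one_le_four_div_three hk (h.nl_mem j) x)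
  have j3' := integrable_finsetSum Finset.univ fun i _ => j3 i
  have e : ∫ t in Ioo 0 T, θ t * rhs k u G p j (t, x)
      = -(∫ t in Ioo 0 T, θ t * sconv (pd j k) p (t, x))
        + (∑ i, ∫ t in Ioo 0 T, θ t * sconv (pd i k) (G i j) (t, x))
        - ∫ t in Ioo 0 T, θ t * sconv k (nl u G j) (t, x) := by
    simp only [rhs, mul_sub, mul_add, mul_neg, Finset.mul_sum]
    rw [integral_sub (by exact j2.neg.add j3') j4, integral_add (by exact j2.neg) j3', integral_neg,
      integral_finsetSum _ fun i _ => j3 i]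
  rw [e]
  linarith

theorem weak_deriv_p (h : CoordSolution T ε u₀ p₀ u G p) (hε : 0 < ε) {k : E3 → ℝ}
    (hk : IsTest univ k) (x : E3) (θ : ℝ → ℝ) (hθ : IsTest (Iio T) θ) :
    -∫ t in Ioo 0 T, deriv θ t * sconv k p (t, x)
      = θ 0 * (k ⋆[ContinuousLinearMap.lsmul ℝ ℝ] p₀) x
        + ∫ t in Ioo 0 T, θ t * (-(ε⁻¹ * ∑ i, sconv (pd i k) (u i) (t, x))) := by
  have hθc := hθ.1.continuous
  have hθ'c : Continuous (deriv θ) := hθ.1.continuous_deriv (by simp)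
  have hθ's : HasCompactSupport (deriv θ) := hθ.2.1.deriv
  have key := h.continuity θ _ hθ (hk.reflect x)
  simp only [pd_reflect hk, neg_mul, mul_neg, sub_neg_eq_add, Finset.sum_neg_distrib] at key
  rw [← convolution_lsmul_eq] at key
  have i1 := integrable_time_mul_kernel_mul one_le_two hk h.p_mem x hθ'c hθ's
  have i3 := fun i => integrable_time_mul_kernel_mul one_le_two (hk.pd i) (h.u_mem i) x hθc hθ.2.1
  have e1 := integral_time_mul_kernel_mul one_le_two hk h.p_mem x hθ'c hθ's
  have e3 := fun i => integral_time_mul_kernel_mul one_le_two (hk.pd i) (h.u_mem i) x hθc hθ.2.1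
  have i3' := integrable_finsetSum Finset.univ fun i _ => i3 i
  rw [integral_add (by exact (i1.const_mul ε).neg) i3', integral_neg, integral_const_mul,
    integral_finsetSum _ fun i _ => i3 i, e1] at key
  simp only [e3] at key
  obtain ⟨C, hC⟩ := hθ.2.1.exists_bound_of_continuous hθc
  have b : ∀ {f : ℝ → ℝ}, IntegrableOn f (Ioo 0 T) → IntegrableOn (fun t => θ t * f t) (Ioo 0 T) :=
    fun hf => hf.bdd_mul hθc.aestronglyMeasurable (Eventually.of_forall hC)
  have j3 := fun i => b (integrableOn_sconv one_le_two (hk.pd i) (h.u_mem i) x)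
  have e : ∫ t in Ioo 0 T, θ t * (-(ε⁻¹ * ∑ i, sconv (pd i k) (u i) (t, x)))
      = -(ε⁻¹ * ∑ i, ∫ t in Ioo 0 T, θ t * sconv (pd i k) (u i) (t, x)) := by
    rw [← integral_finsetSum _ fun i _ => j3 i, ← integral_const_mul, ← integral_neg]
    congr 1
    ext t
    rw [← Finset.mul_sum]
    ring
  rw [e]
  have : ε⁻¹ * ε = 1 := inv_mul_cancel₀ hε.ne'
  linear_combination (ε⁻¹) * key + (∫ t in Ioo 0 T, deriv θ t * sconv k p (t, x)) * this
    + θ 0 * (k ⋆[ContinuousLinearMap.lsmul ℝ ℝ] p₀) x * this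

theorem sconv_mem {k : E3 → ℝ} (hk : IsTest univ k) {f : ℝ × E3 → ℝ} {r : ℝ≥0∞} (hr : 1 ≤ r)
    (hr' : r ≠ ∞) (hf : Measurable f) (hfr : MemLp f r (slab T)) :
    MemLp (sconv k f) r (slab T) :=
  MemLp.sconv hr hr' hk.continuous.measurable hk.integrable hf hfr

theorem rhs_meas (h : CoordSolution T ε u₀ p₀ u G p) {k : E3 → ℝ} (hk : IsTest univ k)
    (j : Fin 3) : Measurable (rhs k u G p j) := by
  have h1 := measurable_sconv (hk.pd j).continuous.measurable h.p_meas
  have h2 := fun i => measurable_sconv (hk.pd i).continuous.measurable (h.G_meas i j)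
  have h3 := measurable_sconv hk.continuous.measurable (h.nl_meas j)
  unfold rhs
  fun_prop

theorem integrable_rhs_mul (h : CoordSolution T ε u₀ p₀ u G p) {k : E3 → ℝ} (hk : IsTest univ k)
    (j : Fin 3) : Integrable (fun z => rhs k u G p j z * sconv k (u j) z) (slab T) := by
  have t2 : (2 : ℝ≥0∞) ≠ ∞ := by simp
  have m1 := sconv_mem (hk.pd j) one_le_two t2 h.p_meas h.p_mem
  have m2 := fun i => sconv_mem (hk.pd i) one_le_two t2 (h.G_meas i j) (h.G_mem i j)
  have m3 := sconv_mem hk one_le_four_div_three four_div_three_ne_top (h.nl_meas j) (h.nl_mem j)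
  have v2 := sconv_mem hk one_le_two t2 (h.u_meas j) (h.u_mem j)
  have v4 := sconv_mem hk (by norm_num) (by simp) (h.u_meas j) (h.u_mem_four j)
  have i1 := (m1.neg.add (memLp_finsetSum Finset.univ fun i _ => m2 i)).integrable_mul v2
  have i2 : Integrable (fun z => sconv k (nl u G j) z * sconv k (u j) z) (slab T) :=
    memLp_one_iff_integrable.1 (v4.mul' m3)
  refine (i1.sub i2).congr (Eventually.of_forall fun z => ?_)
  simp only [rhs, Pi.sub_apply, Pi.mul_apply, Pi.add_apply, Pi.neg_apply, sub_mul]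

theorem integrable_div_mul (h : CoordSolution T ε u₀ p₀ u G p) {k : E3 → ℝ} (hk : IsTest univ k) :
    Integrable (fun z => (∑ i, sconv (pd i k) (u i) z) * sconv k p z) (slab T) := by
  have t2 : (2 : ℝ≥0∞) ≠ ∞ := by simp
  have m1 := sconv_mem hk one_le_two t2 h.p_meas h.p_mem
  have m2 := fun i => sconv_mem (hk.pd i) one_le_two t2 (h.u_meas i) (h.u_mem i)
  exact (memLp_finsetSum Finset.univ fun i _ => m2 i).integrable_mul m1

theorem integral_slab_eq_of_slices {t : ℝ} (ht : t ≤ T) {f g : ℝ × E3 → ℝ}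
    (hf : Integrable f (slab T)) (hg : Integrable g (slab T))
    (hfg : ∀ᵐ s ∂volume.restrict (Ioo 0 T), ∫ x, f (s, x) = ∫ x, g (s, x)) :
    ∫ z, f z ∂slab t = ∫ z, g z ∂slab t := by
  have hf' := hf.mono_measure (slab_mono ht)
  have hg' := hg.mono_measure (slab_mono ht)
  rw [slab] at hf' hg' ⊢
  rw [integral_prod _ hf', integral_prod _ hg']
  exact integral_congr_ae (ae_mono (Measure.restrict_mono (Ioo_subset_Ioo_right ht) le_rfl) hfg)

/-- The commutator in the mollified nonlinear term. -/
def comm (k : E3 → ℝ) (u : Fin 3 → ℝ × E3 → ℝ) (G : Fin 3 → Fin 3 → ℝ × E3 → ℝ)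
    (j : Fin 3) (z : ℝ × E3) : ℝ :=
  sconv k (nl u G j) z - nl (fun j => sconv k (u j)) (fun i j => sconv k (G i j)) j z

theorem comm_mem (h : CoordSolution T ε u₀ p₀ u G p) {k : E3 → ℝ} (hk : IsTest univ k)
    (j : Fin 3) : MemLp (comm k u G j) (4 / 3) (slab T) :=
  (sconv_mem hk one_le_four_div_three four_div_three_ne_top (h.nl_meas j) (h.nl_mem j)).sub
    (memLp_nl (fun j => sconv_mem hk (by norm_num) (by simp) (h.u_meas j) (h.u_mem_four j))
      (fun i j => sconv_mem hk one_le_two (by simp) (h.G_meas i j) (h.G_mem i j)) j)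

theorem integrable_comm_mul (h : CoordSolution T ε u₀ p₀ u G p) {k : E3 → ℝ}
    (hk : IsTest univ k) (j : Fin 3) :
    Integrable (fun z => comm k u G j z * sconv k (u j) z) (slab T) :=
  memLp_one_iff_integrable.1 ((sconv_mem hk (by norm_num) (by simp) (h.u_meas j)
    (h.u_mem_four j)).mul' (h.comm_mem hk j))

theorem integral_rhs_eq (h : CoordSolution T ε u₀ p₀ u G p) {k : E3 → ℝ} (hk : IsTest univ k)
    {t : ℝ} (ht : t ≤ T) :
    (∑ j, ∫ z, rhs k u G p j z * sconv k (u j) z ∂slab t)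
        - ∫ z, (∑ i, sconv (pd i k) (u i) z) * sconv k p z ∂slab t
      = -(∑ j, ∑ i, ∫ z, sconv k (G i j) z ^ 2 ∂slab t)
        - ∑ j, ∫ z, comm k u G j z * sconv k (u j) z ∂slab t := by
  have i1 := fun j => h.integrable_rhs_mul hk j
  have i2 := h.integrable_div_mul hk
  have i3 : ∀ i j, Integrable (fun z => sconv k (G i j) z ^ 2) (slab T) := fun i j =>
    (sconv_mem hk one_le_two (by simp) (h.G_meas i j) (h.G_mem i j)).integrable_sq
  have i4 := fun j => h.integrable_comm_mul hk j
  have i1' := integrable_finsetSum Finset.univ fun j _ => i1 j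
  have i3' := integrable_finsetSum Finset.univ fun j _ =>
    integrable_finsetSum Finset.univ fun i _ => i3 i j
  have i4' := integrable_finsetSum Finset.univ fun j _ => i4 j
  have m := slab_mono ht
  have key := integral_slab_eq_of_slices ht
    (f := fun z => (∑ j, rhs k u G p j z * sconv k (u j) z)
      - (∑ i, sconv (pd i k) (u i) z) * sconv k p z)
    (g := fun z => -(∑ j, ∑ i, sconv k (G i j) z ^ 2) - ∑ j, comm k u G j z * sconv k (u j) z)
    (i1'.sub i2) (i3'.neg.sub i4') ?_
  · rw [integral_sub (i1'.mono_measure m) (i2.mono_measure m),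
      integral_sub (by exact i3'.neg.mono_measure m) (i4'.mono_measure m), integral_neg,
      integral_finsetSum _ fun j _ => (i1 j).mono_measure m,
      integral_finsetSum _ fun j _ => (i4 j).mono_measure m,
      integral_finsetSum _ fun j _ => integrable_finsetSum _ fun i _ => (i3 i j).mono_measure m]
      at key
    rw [key]
    congr 2
    exact Finset.sum_congr rfl fun j _ => integral_finsetSum _ fun i _ => (i3 i j).mono_measure m
  · have s2 : ∀ᵐ s ∂volume.restrict (Ioo 0 T), ∀ j, MemLp (fun x => u j (s, x)) 2 :=
      ae_all_iff.2 fun j => ae_memLp_slice (by simp) (by simp) (h.u_mem j)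
    have s4 : ∀ᵐ s ∂volume.restrict (Ioo 0 T), ∀ j, MemLp (fun x => u j (s, x)) 4 :=
      ae_all_iff.2 fun j => ae_memLp_slice (by simp) (by simp) (h.u_mem_four j)
    have sG : ∀ᵐ s ∂volume.restrict (Ioo 0 T), ∀ i j, MemLp (fun x => G i j (s, x)) 2 :=
      ae_all_iff.2 fun i => ae_all_iff.2 fun j => ae_memLp_slice (by simp) (by simp) (h.G_mem i j)
    have sP := ae_memLp_slice (by simp) (by simp) h.p_mem
    filter_upwards [s2, s4, sG, sP, h.grad] with s h2 h4 hG hP hw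
    have hnl : ∀ j, (fun x => nl u G j (s, x))
        = nl (fun j x => u j (s, x)) (fun i j x => G i j (s, x)) j := fun j => rfl
    have := integral_mollified_balance hk (U := fun j x => u j (s, x))
      (G := fun i j x => G i j (s, x)) (P := fun x => p (s, x))
      (fun j => (h.u_meas j).comp measurable_prodMk_left)
      (fun i j => (h.G_meas i j).comp measurable_prodMk_left)
      (h.p_meas.comp measurable_prodMk_left) h2 h4 hG hP hw
    simp only [rhs, comm, sconv_eq_convolution, hnl]
    simpa only [nl, sconv_eq_convolution] using this

/-- Add the balance for the velocity and `ε` times the balance for the pressure. The factor `ε`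
cancels the `ε⁻¹` of the second equation, which is what allows the pressure and divergence terms to
compensate each other. -/
theorem mollified_energy_eq (h : CoordSolution T ε u₀ p₀ u G p) (hT : 0 < T) (hε : 0 < ε)
    {k : E3 → ℝ} (hk : IsTest univ k) :
    ∀ᵐ t ∂volume.restrict (Ioo 0 T),
      (∑ j, ∫ x, sconv k (u j) (t, x) ^ 2) + ε * (∫ x, sconv k p (t, x) ^ 2)
        + 2 * ∑ j, ∑ i, ∫ z, sconv k (G i j) z ^ 2 ∂slab t
      = (∑ j, ∫ x, (k ⋆[ContinuousLinearMap.lsmul ℝ ℝ] u₀ j) x ^ 2)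
        + ε * (∫ x, (k ⋆[ContinuousLinearMap.lsmul ℝ ℝ] p₀) x ^ 2)
        - 2 * ∑ j, ∫ z, comm k u G j z * sconv k (u j) z ∂slab t := by
  have t2 : (2 : ℝ≥0∞) ≠ ∞ := by simp
  have b0 : ∀ {f : E3 → ℝ}, MemLp f 2 → Measurable (k ⋆[ContinuousLinearMap.lsmul ℝ ℝ] f) :=
    fun hf => (contDiff_convolution hk (hf.locallyIntegrable one_le_two)).continuous.measurable
  have U : ∀ᵐ t ∂volume.restrict (Ioo 0 T), ∀ j, ∫ x, sconv k (u j) (t, x) ^ 2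
      = (∫ x, (k ⋆[ContinuousLinearMap.lsmul ℝ ℝ] u₀ j) x ^ 2)
        + 2 * ∫ z, rhs k u G p j z * sconv k (u j) z ∂slab t := by
    refine ae_all_iff.2 fun j => ae_integral_sq_eq
      (measurable_sconv hk.continuous.measurable (h.u_meas j)) (h.rhs_meas hk j) (b0 (h.u₀_mem j))
      (memLp_convolution one_le_two t2 hk (h.u₀_meas j) (h.u₀_mem j)).integrable_sq
      (h.integrable_rhs_mul hk j) fun x => ?_
    refine ae_sq_eq_of_weak_deriv hT (integrableOn_sconv one_le_two hk (h.u_mem j) x) ?_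
      (h.weak_deriv_u hk j x)
    have j2 := integrableOn_sconv one_le_two (hk.pd j) h.p_mem x
    have j3 := integrable_finsetSum Finset.univ fun i _ =>
      integrableOn_sconv one_le_two (hk.pd i) (h.G_mem i j) x
    have j4 := integrableOn_sconv one_le_four_div_three hk (h.nl_mem j) x
    exact (j2.neg.add j3).sub j4
  have P : ∀ᵐ t ∂volume.restrict (Ioo 0 T), ∫ x, sconv k p (t, x) ^ 2
      = (∫ x, (k ⋆[ContinuousLinearMap.lsmul ℝ ℝ] p₀) x ^ 2)
        + 2 * ∫ z, (-(ε⁻¹ * ∑ i, sconv (pd i k) (u i) z)) * sconv k p z ∂slab t := by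
    have hd : Measurable fun z => -(ε⁻¹ * ∑ i, sconv (pd i k) (u i) z) := by
      have := fun i => measurable_sconv (hk.pd i).continuous.measurable (h.u_meas i)
      fun_prop
    refine ae_integral_sq_eq
      (measurable_sconv hk.continuous.measurable h.p_meas) hd (b0 h.p₀_mem)
      (memLp_convolution one_le_two t2 hk h.p₀_meas h.p₀_mem).integrable_sq ?_ fun x => ?_
    · refine ((h.integrable_div_mul hk).const_mul (-ε⁻¹)).congr (Eventually.of_forall fun z => ?_)
      simp only
      ring
    · refine ae_sq_eq_of_weak_deriv hT (integrableOn_sconv one_le_two hk h.p_mem x) ?_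
        (h.weak_deriv_p hε hk x)
      exact ((integrable_finsetSum Finset.univ fun i _ =>
        integrableOn_sconv one_le_two (hk.pd i) (h.u_mem i) x).const_mul ε⁻¹).neg
  filter_upwards [U, P, ae_restrict_mem measurableSet_Ioo] with t hU hP ht
  have hR := h.integral_rhs_eq hk ht.2.le
  have e : ∫ z, (-(ε⁻¹ * ∑ i, sconv (pd i k) (u i) z)) * sconv k p z ∂slab t
      = -(ε⁻¹ * ∫ z, (∑ i, sconv (pd i k) (u i) z) * sconv k p z ∂slab t) := by
    rw [← integral_const_mul, ← integral_neg]
    congr 1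
    ext z
    ring
  rw [e] at hP
  simp only [hU]
  rw [hP, Finset.sum_add_distrib, ← Finset.mul_sum]
  have hε' : ε * ε⁻¹ = 1 := mul_inv_cancel₀ hε.ne'
  linear_combination 2 * hR
    - 2 * (∫ z, (∑ i, sconv (pd i k) (u i) z) * sconv k p z ∂slab t) * hε'

end CoordSolution

/-! ### The energy equality for velocities in `L⁴` -/

/-- The time interval has length one, so a function of `x` alone has the same norms on the slab;
results for the slab then apply to the initial data and to time slices. -/
theorem measurePreserving_snd_slab_one :
    MeasurePreserving (Prod.snd : ℝ × E3 → E3) (slab 1) volume := by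
  have : IsProbabilityMeasure (volume.restrict (Ioo (0 : ℝ) 1)) := ⟨by simp⟩
  exact measurePreserving_snd

theorem tendsto_eLpNorm_moll_convolution_sub {p : ℝ≥0∞} (hp1 : 1 ≤ p) (hp : p ≠ ∞)
    {f : E3 → ℝ} (hfm : Measurable f) (hf : MemLp f p) :
    Tendsto (fun n => eLpNorm (fun x =>
      (moll n ⋆[ContinuousLinearMap.lsmul ℝ ℝ] f) x - f x) p volume) atTop (𝓝 0) := by
  have h := tendsto_eLpNorm_sconv_moll_sub (T := 1) hp1 hp (f := fun z => f z.2) (by fun_prop)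
    (hf.comp_measurePreserving measurePreserving_snd_slab_one)
  refine h.congr fun n => ?_
  have hm : Measurable (fun x => (moll n ⋆[ContinuousLinearMap.lsmul ℝ ℝ] f) x - f x) :=
    (contDiff_convolution (isTest_moll n)
      (hf.locallyIntegrable hp1)).continuous.measurable.sub hfm
  rw [← eLpNorm_comp_measurePreserving hm.aestronglyMeasurable measurePreserving_snd_slab_one]
  rfl

theorem integral_sq_eq_norm_toLp_sq {X : Type*} [MeasurableSpace X] {μ : Measure X} {f : X → ℝ}
    (hf : MemLp f 2 μ) : ∫ x, f x ^ 2 ∂μ = ‖hf.toLp f‖ ^ 2 := by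
  rw [← real_inner_self_eq_norm_sq, L2.inner_def]
  refine integral_congr_ae ?_
  filter_upwards [hf.coeFn_toLp] with x hx
  simp [hx, sq]

theorem tendsto_integral_sq {X : Type*} [MeasurableSpace X] {μ : Measure X} {f : ℕ → X → ℝ}
    {g : X → ℝ} (hf : ∀ n, MemLp (f n) 2 μ) (hg : MemLp g 2 μ)
    (h : Tendsto (fun n => eLpNorm (fun x => f n x - g x) 2 μ) atTop (𝓝 0)) :
    Tendsto (fun n => ∫ x, f n x ^ 2 ∂μ) atTop (𝓝 (∫ x, g x ^ 2 ∂μ)) := by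
  simp only [integral_sq_eq_norm_toLp_sq (hf _), integral_sq_eq_norm_toLp_sq hg]
  refine Tendsto.pow (Tendsto.norm ?_) 2
  rw [tendsto_iff_edist_tendsto_0]
  refine h.congr fun n => ?_
  rw [Lp.edist_toLp_toLp]
  rfl

namespace CoordSolution

variable {T ε : ℝ} {u₀ : Fin 3 → E3 → ℝ} {p₀ : E3 → ℝ} {u : Fin 3 → ℝ × E3 → ℝ}
  {G : Fin 3 → Fin 3 → ℝ × E3 → ℝ} {p : ℝ × E3 → ℝ}

/-- Both terms of the commutator converge in `L^{4/3}` to the same nonlinearity, while the mollified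
velocity stays bounded in `L⁴`. This limit is where `u ∈ L⁴` is decisive. -/
theorem tendsto_integral_comm_mul (h : CoordSolution T ε u₀ p₀ u G p) {t : ℝ} (ht : t ≤ T)
    (j : Fin 3) :
    Tendsto (fun n => ∫ z, comm (moll n) u G j z * sconv (moll n) (u j) z ∂slab t) atTop (𝓝 0) := by
  have o4 : (1 : ℝ≥0∞) ≤ 4 := by norm_num
  have t2 : (2 : ℝ≥0∞) ≠ ∞ := by simp
  have t4 : (4 : ℝ≥0∞) ≠ ∞ := by simp
  have cm : ∀ n, Measurable (moll n) := fun n => (isTest_moll n).continuous.measurable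
  have young : ∀ n {r : ℝ≥0∞} {f : ℝ × E3 → ℝ}, 1 ≤ r → r ≠ ∞ → Measurable f →
      eLpNorm (sconv (moll n) f) r (slab T) ≤ eLpNorm f r (slab T) := fun n r f h1 h2 hf => by
    simpa [lintegral_enorm_moll] using
      eLpNorm_sconv_le (T := T) h1 h2 (cm n) (isTest_moll n).integrable hf
  have c1 := tendsto_eLpNorm_sconv_moll_sub one_le_four_div_three four_div_three_ne_top
    (h.nl_meas j) (h.nl_mem j)
  have c2 := tendsto_eLpNorm_nl_sub (μ := slab T) (u' := fun n j => sconv (moll n) (u j))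
    (G' := fun n i j => sconv (moll n) (G i j)) h.u_mem_four h.G_mem
    (fun n j => (measurable_sconv (cm n) (h.u_meas j)).aestronglyMeasurable)
    (fun n i j => (measurable_sconv (cm n) (h.G_meas i j)).aestronglyMeasurable)
    (fun n i j => young n one_le_two t2 (h.G_meas i j))
    (fun j => tendsto_eLpNorm_sconv_moll_sub o4 t4 (h.u_meas j) (h.u_mem_four j))
    (fun i j => tendsto_eLpNorm_sconv_moll_sub one_le_two t2 (h.G_meas i j) (h.G_mem i j)) j
  have c3 : Tendsto (fun n => eLpNorm (comm (moll n) u G j) (4 / 3) (slab T)) atTop (𝓝 0) := by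
    have c := c1.add c2
    rw [add_zero] at c
    refine tendsto_of_tendsto_of_tendsto_of_le_of_le tendsto_const_nhds c (fun _ => zero_le)
      fun n => ?_
    have e : comm (moll n) u G j = (fun z => sconv (moll n) (nl u G j) z - nl u G j z)
        - fun z => nl (fun j => sconv (moll n) (u j)) (fun i j => sconv (moll n) (G i j)) j z
          - nl u G j z := by
      ext z
      simp [comm]
    have m1 := (sconv_mem (isTest_moll n) one_le_four_div_three four_div_three_ne_top
      (h.nl_meas j) (h.nl_mem j)).sub (h.nl_mem j)
    have m2 := (memLp_nl (fun j => sconv_mem (isTest_moll n) o4 t4 (h.u_meas j) (h.u_mem_four j))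
      (fun i j => sconv_mem (isTest_moll n) one_le_two t2 (h.G_meas i j) (h.G_mem i j)) j).sub
        (h.nl_mem j)
    change eLpNorm (comm (moll n) u G j) (4 / 3) (slab T) ≤ _
    rw [e]
    exact eLpNorm_sub_le m1.1 m2.1 one_le_four_div_three
  rw [tendsto_zero_iff_norm_tendsto_zero]
  have c4 := ENNReal.Tendsto.mul_const (b := eLpNorm (u j) 4 (slab T)) c3
    (Or.inr (h.u_mem_four j).2.ne)
  rw [zero_mul] at c4
  have c5 := (ENNReal.tendsto_toReal ENNReal.zero_ne_top).comp c4
  refine squeeze_zero (fun n => norm_nonneg _) (fun n => ?_) c5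
  have hb : ‖∫ z, comm (moll n) u G j z * sconv (moll n) (u j) z ∂slab t‖ₑ
      ≤ eLpNorm (comm (moll n) u G j) (4 / 3) (slab T) * eLpNorm (u j) 4 (slab T) := by
    calc ‖∫ z, comm (moll n) u G j z * sconv (moll n) (u j) z ∂slab t‖ₑ
        ≤ ∫⁻ z, ‖comm (moll n) u G j z * sconv (moll n) (u j) z‖ₑ ∂slab t :=
          enorm_integral_le_lintegral_enorm _
      _ ≤ ∫⁻ z, ‖comm (moll n) u G j z * sconv (moll n) (u j) z‖ₑ ∂slab T :=
          lintegral_mono' (slab_mono ht) le_rfl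
      _ = eLpNorm (fun z => comm (moll n) u G j z * sconv (moll n) (u j) z) 1 (slab T) :=
          eLpNorm_one_eq_lintegral_enorm.symm
      _ ≤ eLpNorm (comm (moll n) u G j) (4 / 3) (slab T)
          * eLpNorm (sconv (moll n) (u j)) 4 (slab T) :=
          eLpNorm_mul_le_mul_eLpNorm (h.comm_mem (isTest_moll n) j).1
            (measurable_sconv (cm n) (h.u_meas j)).aestronglyMeasurable
      _ ≤ _ := mul_le_mul_right (young n o4 t4 (h.u_meas j)) _
  have := ENNReal.toReal_mono
    (ENNReal.mul_ne_top (h.comm_mem (isTest_moll n) j).2.ne (h.u_mem_four j).2.ne) hb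
  simpa using this

theorem energy_eq (h : CoordSolution T ε u₀ p₀ u G p) (hT : 0 < T) (hε : 0 < ε) :
    ∀ᵐ t ∂volume.restrict (Ioo 0 T),
      (∑ j, ∫ x, u j (t, x) ^ 2) + ε * (∫ x, p (t, x) ^ 2)
        + 2 * ∑ j, ∑ i, ∫ z, G i j z ^ 2 ∂slab t
      = (∑ j, ∫ x, u₀ j x ^ 2) + ε * ∫ x, p₀ x ^ 2 := by
  have t2 : (2 : ℝ≥0∞) ≠ ∞ := by simp
  have conv : ∀ {f : E3 → ℝ}, Measurable f → MemLp f 2 →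
      Tendsto (fun n => ∫ x, (moll n ⋆[ContinuousLinearMap.lsmul ℝ ℝ] f) x ^ 2) atTop
        (𝓝 (∫ x, f x ^ 2)) := fun hm hf =>
    tendsto_integral_sq (fun n => memLp_convolution one_le_two t2 (isTest_moll n) hm hf) hf
      (tendsto_eLpNorm_moll_convolution_sub one_le_two t2 hm hf)
  have s2 : ∀ᵐ s ∂volume.restrict (Ioo 0 T), ∀ j, MemLp (fun x => u j (s, x)) 2 :=
    ae_all_iff.2 fun j => ae_memLp_slice (by simp) t2 (h.u_mem j)
  -- The mollifiers form a sequence, so the exceptional times for all `n` still form a null set.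
  filter_upwards [s2, ae_memLp_slice (by simp) t2 h.p_mem, ae_restrict_mem measurableSet_Ioo,
    ae_all_iff.2 fun n => h.mollified_energy_eq hT hε (isTest_moll n)] with t hu hp ht hn
  have m := slab_mono ht.2.le
  have l1 := tendsto_finsetSum (Finset.univ : Finset (Fin 3)) fun j _ =>
    conv ((h.u_meas j).comp measurable_prodMk_left) (hu j)
  have l2 := conv (h.p_meas.comp measurable_prodMk_left) hp
  have l3 := tendsto_finsetSum (Finset.univ : Finset (Fin 3)) fun j _ =>
    tendsto_finsetSum (Finset.univ : Finset (Fin 3)) fun i _ =>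
      tendsto_integral_sq (fun n => sconv_mem (isTest_moll n) one_le_two t2 (h.G_meas i j)
        ((h.G_mem i j).mono_measure m)) ((h.G_mem i j).mono_measure m)
        (tendsto_eLpNorm_sconv_moll_sub one_le_two t2 (h.G_meas i j)
          ((h.G_mem i j).mono_measure m))
  have l4 := tendsto_finsetSum (Finset.univ : Finset (Fin 3)) fun j _ =>
    conv (h.u₀_meas j) (h.u₀_mem j)
  have l5 := conv h.p₀_meas h.p₀_mem
  have l6 := tendsto_finsetSum (Finset.univ : Finset (Fin 3)) fun j _ =>
    h.tendsto_integral_comm_mul ht.2.le j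
  have L := (l1.add (l2.const_mul ε)).add (l3.const_mul 2)
  have R := (l4.add (l5.const_mul ε)).sub (l6.const_mul 2)
  simp only [Finset.sum_const_zero, mul_zero, sub_zero] at R
  refine tendsto_nhds_unique L (R.congr fun n => ?_)
  rw [← hn n]
  simp only [sconv_eq_convolution]
  rfl

end CoordSolution

/-! ### From the weak formulation to coordinates -/

theorem isTest_prod {T : ℝ} {θ : ℝ → ℝ} {ψ : E3 → ℝ} (hθ : IsTest (Iio T) θ)
    (hψ : IsTest univ ψ) : IsTest (Iio T ×ˢ univ) fun z : ℝ × E3 => θ z.1 * ψ z.2 := by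
  have hsub : tsupport (fun z : ℝ × E3 => θ z.1 * ψ z.2) ⊆ tsupport θ ×ˢ tsupport ψ := by
    refine closure_minimal (fun z hz => ?_)
      ((isClosed_tsupport θ).prod (isClosed_tsupport ψ))
    exact ⟨subset_tsupport θ (left_ne_zero_of_mul hz), subset_tsupport ψ (right_ne_zero_of_mul hz)⟩
  exact ⟨(hθ.1.comp contDiff_fst).mul (hψ.1.comp contDiff_snd),
    (hθ.2.1.isCompact.prod hψ.2.1.isCompact).of_isClosed_subset (isClosed_tsupport _) hsub,
    hsub.trans (prod_mono hθ.2.2 hψ.2.2)⟩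

theorem hasFDerivAt_prod {T : ℝ} {θ : ℝ → ℝ} {ψ : E3 → ℝ} (hθ : IsTest (Iio T) θ)
    (hψ : IsTest univ ψ) (z : ℝ × E3) :
    HasFDerivAt (fun z : ℝ × E3 => θ z.1 * ψ z.2)
      (θ z.1 • (fderiv ℝ ψ z.2).comp (ContinuousLinearMap.snd ℝ ℝ E3)
        + ψ z.2 • (fderiv ℝ θ z.1).comp (ContinuousLinearMap.fst ℝ ℝ E3)) z :=
  (((hθ.1.differentiable (by simp) z.1).hasFDerivAt).comp z hasFDerivAt_fst).mul
    (((hψ.1.differentiable (by simp) z.2).hasFDerivAt).comp z hasFDerivAt_snd)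

theorem dt_prod {T : ℝ} {θ : ℝ → ℝ} {ψ : E3 → ℝ} (hθ : IsTest (Iio T) θ)
    (hψ : IsTest univ ψ) (z : ℝ × E3) :
    dt (fun z : ℝ × E3 => θ z.1 * ψ z.2) z = deriv θ z.1 * ψ z.2 := by
  rw [dt, (hasFDerivAt_prod hθ hψ z).fderiv]
  simp [mul_comm]

theorem dx_prod {T : ℝ} {θ : ℝ → ℝ} {ψ : E3 → ℝ} (hθ : IsTest (Iio T) θ)
    (hψ : IsTest univ ψ) (i : Fin 3) (z : ℝ × E3) :
    dx i (fun z : ℝ × E3 => θ z.1 * ψ z.2) z = θ z.1 * pd i ψ z.2 := by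
  rw [dx, (hasFDerivAt_prod hθ hψ z).fderiv]
  simp [pd]

theorem isTest_smul_const {Ω : Set (ℝ × E3)} {φ : ℝ × E3 → ℝ} (hφ : IsTest Ω φ) (e : E3) :
    IsTest Ω fun z => φ z • e := by
  have hsub : tsupport (fun z => φ z • e) ⊆ tsupport φ :=
    closure_mono fun z hz h0 => hz (by simp [show φ z = 0 from h0])
  exact ⟨hφ.1.smul contDiff_const, hφ.2.1.isCompact.of_isClosed_subset (isClosed_tsupport _) hsub,
    hsub.trans hφ.2.2⟩

theorem fderiv_smul_const_apply {Ω : Set (ℝ × E3)} {φ : ℝ × E3 → ℝ} (hφ : IsTest Ω φ) (e : E3)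
    (z w : ℝ × E3) : fderiv ℝ (fun z => φ z • e) z w = fderiv ℝ φ z w • e := by
  have h : HasFDerivAt (fun z => φ z • e) _ z :=
    (hφ.1.differentiable (by simp) z).hasFDerivAt.smul_const e
  rw [h.fderiv]
  simp

/-- Hölder in time on the bounded interval `(0,T)`. -/
theorem eLpNorm_uncurry_le_mixedNorm_top {V : Type*} [NormedAddCommGroup V] {T : ℝ}
    {f : ℝ → E3 → V} (hf : AEStronglyMeasurable (Function.uncurry f) (slab T)) :
    eLpNorm (Function.uncurry f) 2 (slab T)
      ≤ mixedNorm T ∞ 2 f * volume (Ioo 0 T) ^ (1 / (2 : ℝ)) := by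
  rw [slab, eLpNorm_prod (by simp) (by simp) hf]
  have h1 : ∀ᵐ t ∂volume.restrict (Ioo 0 T), ‖eLpNorm (f t) 2 volume‖ₑ ≤ ‖mixedNorm T ∞ 2 f‖ₑ := by
    have := ae_le_eLpNormEssSup (f := fun t => eLpNorm (f t) 2 volume) (μ := volume.restrict (Ioo 0 T))
    simpa [mixedNorm, eLpNorm_exponent_top] using this
  refine (eLpNorm_mono_enorm_ae (g := fun _ => mixedNorm T ∞ 2 f) h1).trans (le_of_eq ?_)
  rw [eLpNorm_const' _ (by simp) (by simp)]
  simp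

theorem memLp_two_of_memMixed_top {V : Type*} [NormedAddCommGroup V] {T : ℝ} {f : ℝ → E3 → V}
    (hf : MemMixed T ∞ 2 f) : MemLp (Function.uncurry f) 2 (slab T) :=
  ⟨hf.1, (eLpNorm_uncurry_le_mixedNorm_top hf.1).trans_lt (ENNReal.mul_lt_top hf.2
    (ENNReal.rpow_lt_top_of_nonneg (by positivity) (by simp)))⟩

theorem memLp_two_of_memMixed_two {V : Type*} [NormedAddCommGroup V] {T : ℝ} {f : ℝ → E3 → V}
    (hf : MemMixed T 2 2 f) : MemLp (Function.uncurry f) 2 (slab T) := by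
  refine ⟨hf.1, ?_⟩
  rw [slab, eLpNorm_prod (by simp) (by simp) hf.1]
  exact hf.2

theorem IsWeakPartial.congr_ae {i : Fin 3} {v g v' g' : E3 → ℝ} (h : IsWeakPartial i v g)
    (hv : v =ᵐ[volume] v') (hg : g =ᵐ[volume] g') : IsWeakPartial i v' g' := by
  refine ⟨fun x => ?_, fun x => ?_, fun ψ hψ => ?_⟩
  · obtain ⟨s, hs, hi⟩ := h.1 x
    exact ⟨s, hs, hi.congr (ae_restrict_of_ae hv)⟩
  · obtain ⟨s, hs, hi⟩ := h.2.1 x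
    exact ⟨s, hs, hi.congr (ae_restrict_of_ae hg)⟩
  · have h1 : ∫ x, pd i ψ x * v' x = ∫ x, pd i ψ x * v x :=
      integral_congr_ae (hv.mono fun x hx => by simp only [hx])
    have h2 : ∫ x, ψ x * g' x = ∫ x, ψ x * g x :=
      integral_congr_ae (hg.mono fun x hx => by simp only [hx])
    rw [h1, h2]
    exact h.2.2 ψ hψ

theorem MemLp.coord {X : Type*} [MeasurableSpace X] {μ : Measure X} {r : ℝ≥0∞} {f : X → E3}
    (hf : MemLp f r μ) (j : Fin 3) : MemLp (fun x => f x j) r μ :=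
  (EuclideanSpace.proj (𝕜 := ℝ) (ι := Fin 3) j).comp_memLp' hf

theorem MemLp.coord₂ {X : Type*} [MeasurableSpace X] {μ : Measure X} {r : ℝ≥0∞} {f : X → Grad3}
    (hf : MemLp f r μ) (i j : Fin 3) : MemLp (fun x => f x i j) r μ :=
  MemLp.coord ((PiLp.proj 2 (𝕜 := ℝ) (fun _ : Fin 3 => E3) i).comp_memLp' hf) j

theorem inner_smul_unitVec (v : E3) (c : ℝ) (j : Fin 3) :
    inner ℝ v (c • unitVec j) = c * v j := by
  rw [inner_smul_right, unitVec, EuclideanSpace.inner_single_right]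
  simp

theorem convec_apply (v : E3) (g : Grad3) (j : Fin 3) : convec v g j = ∑ i, v i * g i j := by
  simp [convec]

namespace IsWeakSolution

variable {T ε : ℝ} {u₀ : E3 → E3} {p₀ : E3 → ℝ} {u : ℝ → E3 → E3} {G : ℝ → E3 → Grad3}
  {p : ℝ → E3 → ℝ}

theorem p_memLp (h : IsWeakSolution T ε u₀ p₀ u G p) (hε : 0 < ε) :
    MemLp (Function.uncurry p) 2 (slab T) := by
  have h1 := (memLp_two_of_memMixed_top h.p_mem).const_mul (√ε)⁻¹
  refine (memLp_congr_ae (Eventually.of_forall fun z => ?_)).1 h1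
  have : √ε ≠ 0 := (Real.sqrt_pos.2 hε).ne'
  simp only [Function.uncurry]
  field_simp

/-- Borel representatives make convolutions jointly measurable. Test fields `θ(t) ψ(x) eⱼ` extract
the `j`-th component of the momentum equation, and Fubini carries the weak gradient over to almost
every slice. -/
theorem exists_coordSolution (h : IsWeakSolution T ε u₀ p₀ u G p) (hε : 0 < ε)
    (h4 : MemLp (Function.uncurry u) 4 (slab T)) :
    ∃ (v₀ : Fin 3 → E3 → ℝ) (q₀ : E3 → ℝ) (v : Fin 3 → ℝ × E3 → ℝ) (D : Fin 3 → Fin 3 → ℝ × E3 → ℝ)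
      (q : ℝ × E3 → ℝ), CoordSolution T ε v₀ q₀ v D q ∧ (∀ᵐ x, ∀ j, v₀ j x = u₀ x j) ∧
      (q₀ =ᵐ[volume] p₀) ∧ (∀ᵐ z ∂slab T, ∀ j, v j z = u z.1 z.2 j) ∧
      (∀ᵐ z ∂slab T, ∀ i j, D i j z = G z.1 z.2 i j) ∧ (∀ᵐ z ∂slab T, q z = p z.1 z.2) := by
  have u2 := memLp_two_of_memMixed_top h.u_mem
  have G2 := memLp_two_of_memMixed_two h.G_mem
  have p2 := h.p_memLp hε
  have cu := fun j => MemLp.coord u2 j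
  have cG := fun i j => MemLp.coord₂ G2 i j
  have cu0 := fun j => MemLp.coord h.u₀_mem j
  set v₀ : Fin 3 → E3 → ℝ := fun j => (cu0 j).1.mk _ with hv₀
  set q₀ : E3 → ℝ := h.p₀_mem.1.mk _ with hq₀
  set v : Fin 3 → ℝ × E3 → ℝ := fun j => (cu j).1.mk _ with hv
  set D : Fin 3 → Fin 3 → ℝ × E3 → ℝ := fun i j => (cG i j).1.mk _ with hD
  set q : ℝ × E3 → ℝ := p2.1.mk _ with hq
  have ev₀ := fun j => (cu0 j).1.ae_eq_mk
  have eq₀ := h.p₀_mem.1.ae_eq_mk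
  have ev := fun j => (cu j).1.ae_eq_mk
  have eD := fun i j => (cG i j).1.ae_eq_mk
  have eq := p2.1.ae_eq_mk
  have av : ∀ᵐ z ∂slab T, ∀ j, v j z = u z.1 z.2 j :=
    ae_all_iff.2 fun j => (ev j).mono fun z hz => hz.symm
  have aD : ∀ᵐ z ∂slab T, ∀ i j, D i j z = G z.1 z.2 i j :=
    ae_all_iff.2 fun i => ae_all_iff.2 fun j => (eD i j).mono fun z hz => hz.symm
  have aq : ∀ᵐ z ∂slab T, q z = p z.1 z.2 := eq.mono fun z hz => hz.symm
  refine ⟨v₀, q₀, v, D, q, ?_, ae_all_iff.2 fun j => (ev₀ j).mono fun z hz => hz.symm, eq₀.symm,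
    av, aD, aq⟩
  refine
    { u₀_meas := fun j => (cu0 j).1.stronglyMeasurable_mk.measurable
      p₀_meas := h.p₀_mem.1.stronglyMeasurable_mk.measurable
      u_meas := fun j => (cu j).1.stronglyMeasurable_mk.measurable
      G_meas := fun i j => (cG i j).1.stronglyMeasurable_mk.measurable
      p_meas := p2.1.stronglyMeasurable_mk.measurable
      u₀_mem := fun j => (cu0 j).ae_eq (ev₀ j)
      p₀_mem := h.p₀_mem.ae_eq eq₀
      u_mem := fun j => (cu j).ae_eq (ev j)
      u_mem_four := fun j => (MemLp.coord h4 j).ae_eq (ev j)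
      G_mem := fun i j => (cG i j).ae_eq (eD i j)
      p_mem := p2.ae_eq eq
      grad := ?_
      momentum := ?_
      continuity := ?_ }
  · have sv := Measure.ae_ae_of_ae_prod av
    have sD := Measure.ae_ae_of_ae_prod aD
    filter_upwards [h.grad, sv, sD] with t hw h1 h2 i j
    exact (hw.isWeakPartial i j).congr_ae (h1.mono fun x hx => (hx j).symm)
      (h2.mono fun x hx => (hx i j).symm)
  · intro j θ ψ hθ hψ
    have hΦ := isTest_prod hθ hψ
    have key := h.momentum _ (isTest_smul_const hΦ (unitVec j))
    have e1 : ∫ x, inner ℝ (u₀ x) ((θ 0 * ψ x) • unitVec j) = θ 0 * ∫ x, ψ x * v₀ j x := by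
      rw [← integral_const_mul]
      refine integral_congr_ae ((ev₀ j).mono fun x hx => ?_)
      simp only [inner_smul_unitVec, hv₀, ← hx]
      ring
    simp only at key
    rw [← e1, ← key]
    refine integral_congr_ae ?_
    filter_upwards [av, aD, aq] with z h1 h2 h3
    have d1 : dt (fun z : ℝ × E3 => (θ z.1 * ψ z.2) • unitVec j) z
        = (deriv θ z.1 * ψ z.2) • unitVec j := by
      rw [dt, fderiv_smul_const_apply hΦ]
      congr 1
      exact dt_prod hθ hψ z
    have d2 : ∀ i, dx i (fun z : ℝ × E3 => (θ z.1 * ψ z.2) • unitVec j) z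
        = (θ z.1 * pd i ψ z.2) • unitVec j := fun i => by
      rw [dx, fderiv_smul_const_apply hΦ]
      congr 1
      exact dx_prod hθ hψ i z
    have d3 : ∑ i, ((θ z.1 * pd i ψ z.2) • unitVec j) i = θ z.1 * pd j ψ z.2 := by
      simp [unitVec]
    simp only [d1, d2]
    rw [d3]
    simp only [inner_smul_unitVec, convec_apply, nl, h1, h2, h3, PiLp.smul_apply,
      smul_eq_mul, divg, Finset.sum_add_distrib, Finset.mul_sum, Finset.sum_mul, mul_add, add_assoc]
    congr 1
    · ring
    congr 1
    · exact Finset.sum_congr rfl fun i _ => by ring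
    congr 1
    · exact Finset.sum_congr rfl fun i _ => by ring
    · exact Finset.sum_congr rfl fun i _ => by ring
  · intro θ ψ hθ hψ
    have key := h.continuity _ (isTest_prod hθ hψ)
    have e1 : ∫ x, ε * p₀ x * (θ 0 * ψ x) = θ 0 * (ε * ∫ x, ψ x * q₀ x) := by
      rw [← integral_const_mul, ← integral_const_mul]
      refine integral_congr_ae (eq₀.mono fun x hx => ?_)
      simp only [hq₀, ← hx]
      ring
    simp only at key
    rw [← e1, ← key]
    refine integral_congr_ae ?_
    filter_upwards [av, aq] with z h1 h3
    simp only [dt_prod hθ hψ, dx_prod hθ hψ, h1, h3]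
    congr 1
    · ring
    · exact Finset.sum_congr rfl fun i _ => by ring

/-- The inequality is half of the energy equality in coordinates; finiteness of all terms permits
the passage from real integrals to extended ones. -/
theorem energyInequality (h : IsWeakSolution T ε u₀ p₀ u G p) (hT : 0 < T) (hε : 0 < ε)
    (h4 : MemLp (Function.uncurry u) 4 (slab T)) : EnergyInequality T ε u₀ p₀ u G p := by
  obtain ⟨v₀, q₀, v, D, q, hs, e1, e2, e3, e4, e5⟩ := h.exists_coordSolution hε h4
  have t2 : (2 : ℝ≥0∞) ≠ ∞ := by simp
  have s2 : ∀ᵐ s ∂volume.restrict (Ioo 0 T), ∀ j, MemLp (fun x => v j (s, x)) 2 :=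
    ae_all_iff.2 fun j => ae_memLp_slice (by simp) t2 (hs.u_mem j)
  filter_upwards [hs.energy_eq hT hε, s2, ae_memLp_slice (by simp) t2 hs.p_mem,
    Measure.ae_ae_of_ae_prod e3, Measure.ae_ae_of_ae_prod e5, ae_restrict_mem measurableSet_Ioo]
    with t ht hv hq k3 k5 htT
  have m := slab_mono htT.2.le
  have conv : ∀ {w : Fin 3 → E3 → ℝ} {r : E3 → ℝ} {w' : E3 → E3} {r' : E3 → ℝ},
      (∀ j, MemLp (w j) 2) → MemLp r 2 → (∀ᵐ x, ∀ j, w j x = w' x j) → (∀ᵐ x, r x = r' x) →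
      ∫⁻ x, ENNReal.ofReal (‖w' x‖ ^ 2 / 2 + ε / 2 * r' x ^ 2)
        = ENNReal.ofReal (((∑ j, ∫ x, w j x ^ 2) + ε * ∫ x, r x ^ 2) / 2) := by
    intro w r w' r' hw hr hww' hrr'
    have i1 := integrable_finsetSum Finset.univ fun j _ => (hw j).integrable_sq
    have i2 := hr.integrable_sq.const_mul ε
    have i3 : Integrable fun x => ((∑ j, w j x ^ 2) + ε * r x ^ 2) / 2 := (i1.add i2).div_const 2
    rw [← integral_finsetSum _ fun j _ => (hw j).integrable_sq, ← integral_const_mul,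
      ← integral_add i1 i2, ← integral_div, ofReal_integral_eq_lintegral_ofReal i3]
    · refine lintegral_congr_ae ?_
      filter_upwards [hww', hrr'] with x h1 h2
      simp only [EuclideanSpace.real_norm_sq_eq, h1, h2]
      congr 1
      ring
    · refine Eventually.of_forall fun x => ?_
      simp only [Pi.zero_apply]
      have : 0 ≤ ∑ j, w j x ^ 2 := Finset.sum_nonneg fun _ _ => sq_nonneg _
      positivity
  rw [conv hv hq k3 k5, conv hs.u₀_mem hs.p₀_mem e1 e2, ← ht]
  have iG : ∀ i j, Integrable (fun z => D i j z ^ 2) (slab t) := fun i j =>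
    ((hs.G_mem i j).mono_measure m).integrable_sq
  have iG' := integrable_finsetSum Finset.univ fun j _ =>
    integrable_finsetSum Finset.univ fun i _ => iG i j
  have hGe : ∫⁻ s in Ioo 0 t, ∫⁻ x, ENNReal.ofReal (‖G s x‖ ^ 2)
      = ENNReal.ofReal (∑ j, ∑ i, ∫ z, D i j z ^ 2 ∂slab t) := by
    have c : ∑ j, ∑ i, ∫ z, D i j z ^ 2 ∂slab t = ∫ z, ∑ j, ∑ i, D i j z ^ 2 ∂slab t := by
      rw [integral_finsetSum _ fun j _ => integrable_finsetSum _ fun i _ => iG i j]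
      exact Finset.sum_congr rfl fun j _ => (integral_finsetSum _ fun i _ => iG i j).symm
    rw [c, ofReal_integral_eq_lintegral_ofReal iG' (Eventually.of_forall fun z =>
      Finset.sum_nonneg fun _ _ => Finset.sum_nonneg fun _ _ => sq_nonneg _)]
    have hm : AEMeasurable (fun z => ENNReal.ofReal (∑ j, ∑ i, D i j z ^ 2)) (slab t) :=
      iG'.1.aemeasurable.ennreal_ofReal
    rw [slab] at hm ⊢
    rw [lintegral_prod _ hm]
    have k4 : ∀ᵐ s ∂volume.restrict (Ioo 0 t), ∀ᵐ x, ∀ i j, D i j (s, x) = G s x i j := ae_mono (Measure.restrict_mono (Ioo_subset_Ioo_right htT.2.le) le_rfl)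
      (Measure.ae_ae_of_ae_prod e4)
    refine lintegral_congr_ae (k4.mono fun s hs => ?_)
    refine lintegral_congr_ae (hs.mono fun x hx => ?_)
    simp only [hx]
    rw [PiLp.norm_sq_eq_of_L2, Finset.sum_comm]
    simp only [EuclideanSpace.real_norm_sq_eq]
  rw [hGe, ← ENNReal.ofReal_add]
  · refine le_of_eq (congrArg _ ?_)
    ring
  · have h1 : 0 ≤ ∑ j, ∫ x, v j (t, x) ^ 2 :=
      Finset.sum_nonneg fun _ _ => integral_nonneg fun _ => sq_nonneg _
    have h2 : 0 ≤ ∫ x, q (t, x) ^ 2 := integral_nonneg fun _ => sq_nonneg _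
    positivity
  · exact Finset.sum_nonneg fun _ _ => Finset.sum_nonneg fun _ _ =>
      integral_nonneg fun _ => sq_nonneg _

end IsWeakSolution

/-! ### Bounds that follow from the energy inequality -/

theorem lintegral_ofReal_norm_sq {X V : Type*} [MeasurableSpace X] [NormedAddCommGroup V]
    (μ : Measure X) (f : X → V) : ∫⁻ x, ENNReal.ofReal (‖f x‖ ^ 2) ∂μ = eLpNorm f 2 μ ^ 2 := by
  rw [eLpNorm_eq_lintegral_rpow_enorm_toReal (by simp) (by simp), ← ENNReal.rpow_natCast,
    ← ENNReal.rpow_mul]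
  simp [ENNReal.ofReal_pow]

theorem two_mul_ofReal (r : ℝ) : 2 * ENNReal.ofReal r = ENNReal.ofReal (2 * r) := by
  rw [ENNReal.ofReal_mul (by simp)]
  simp

/-- Turns a bound on a squared norm into a bound on the norm without square roots; the summand `1`
in the final constants comes from here. -/
theorem le_sq_add_one (x : ℝ≥0∞) : x ≤ x ^ 2 + 1 := by
  rcases le_total x 1 with h | h
  · exact h.trans le_add_self
  · exact (le_mul_of_one_le_right' h).trans (by rw [← sq]; exact le_self_add)

theorem mixedNorm_two_two_eq {V : Type*} [NormedAddCommGroup V] {T : ℝ} {f : ℝ → E3 → V}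
    (hf : AEStronglyMeasurable (Function.uncurry f) (slab T)) :
    mixedNorm T 2 2 f = eLpNorm (Function.uncurry f) 2 (slab T) := by
  rw [slab, eLpNorm_prod (by simp) (by simp) hf]
  rfl

/-- The bound holds only at almost every time. The left side is monotone in `t`, so any `t < T` is
dominated by a good time in between, and `(0,T)` is exhausted by shorter intervals. -/
theorem setLIntegral_Ioo_le_of_ae {T : ℝ} {g : ℝ → ℝ≥0∞} {E : ℝ≥0∞} (hT : 0 < T)
    (h : ∀ᵐ t ∂volume.restrict (Ioo 0 T), ∫⁻ s in Ioo 0 t, g s ≤ E) :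
    ∫⁻ s in Ioo 0 T, g s ≤ E := by
  have h1 : ∀ t < T, ∫⁻ s in Ioo 0 t, g s ≤ E := by
    intro t ht
    have hpos : 0 < volume (Ioo (max 0 t) T) := by simp [hT, ht]
    rw [ae_restrict_iff' measurableSet_Ioo] at h
    obtain ⟨r, hr, hrE⟩ := (frequently_ae_mem_iff.2 hpos.ne').and_eventually h |>.exists
    refine le_trans ?_ (hrE ⟨(le_max_left _ _).trans_lt hr.1, hr.2⟩)
    exact lintegral_mono' (Measure.restrict_mono
      (Ioo_subset_Ioo_right ((le_max_right _ _).trans hr.1.le)) le_rfl) le_rfl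
  have hU : Ioo 0 T = ⋃ n : ℕ, Ioo 0 (T - 1 / (n + 1 : ℝ)) := by
    ext s
    simp only [mem_Ioo, mem_iUnion]
    constructor
    · rintro ⟨h0, hs⟩
      obtain ⟨n, hn⟩ := exists_nat_one_div_lt (sub_pos.2 hs)
      exact ⟨n, h0, by linarith⟩
    · rintro ⟨n, h0, hs⟩
      have : (0 : ℝ) < 1 / (n + 1 : ℝ) := by positivity
      exact ⟨h0, by linarith⟩
  rw [hU, setLIntegral_iUnion_of_directed]
  · exact iSup_le fun n => h1 _ (by
      have : (0 : ℝ) < 1 / (n + 1 : ℝ) := by positivity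
      linarith)
  · refine directed_of_isDirected_le fun m n hmn => Ioo_subset_Ioo_right ?_
    have : 1 / (n + 1 : ℝ) ≤ 1 / (m + 1 : ℝ) := by gcongr
    linarith

namespace EnergyInequality

variable {T ε : ℝ} {u₀ : E3 → E3} {p₀ : E3 → ℝ} {u : ℝ → E3 → E3} {G : ℝ → E3 → Grad3}
  {p : ℝ → E3 → ℝ}

theorem ae_eLpNorm_u_sq_le (h : EnergyInequality T ε u₀ p₀ u G p) (hε : 0 < ε) {E : ℝ≥0∞}
    (hE : ∫⁻ x, ENNReal.ofReal (‖u₀ x‖ ^ 2 / 2 + ε / 2 * p₀ x ^ 2) ≤ E) :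
    ∀ᵐ t ∂volume.restrict (Ioo 0 T), eLpNorm (u t) 2 volume ^ 2 ≤ 2 * E := by
  filter_upwards [h] with t ht
  rw [← lintegral_ofReal_norm_sq]
  calc ∫⁻ x, ENNReal.ofReal (‖u t x‖ ^ 2)
      ≤ ∫⁻ x, 2 * ENNReal.ofReal (‖u t x‖ ^ 2 / 2 + ε / 2 * p t x ^ 2) := by
        refine lintegral_mono fun x => ?_
        rw [two_mul_ofReal]
        refine ENNReal.ofReal_le_ofReal ?_
        have : 0 ≤ ε / 2 * p t x ^ 2 := by positivity
        linarith
    _ = 2 * ∫⁻ x, ENNReal.ofReal (‖u t x‖ ^ 2 / 2 + ε / 2 * p t x ^ 2) :=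
        lintegral_const_mul' _ _ (by simp)
    _ ≤ 2 * E := by
        gcongr
        exact le_self_add.trans (ht.trans hE)

theorem ae_eLpNorm_p_sq_le (h : EnergyInequality T ε u₀ p₀ u G p) (hε : 0 < ε) {E : ℝ≥0∞}
    (hE : ∫⁻ x, ENNReal.ofReal (‖u₀ x‖ ^ 2 / 2 + ε / 2 * p₀ x ^ 2) ≤ E) :
    ∀ᵐ t ∂volume.restrict (Ioo 0 T), eLpNorm (fun x => √ε * p t x) 2 volume ^ 2 ≤ 2 * E := by
  filter_upwards [h] with t ht
  rw [← lintegral_ofReal_norm_sq]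
  calc ∫⁻ x, ENNReal.ofReal (‖√ε * p t x‖ ^ 2)
      ≤ ∫⁻ x, 2 * ENNReal.ofReal (‖u t x‖ ^ 2 / 2 + ε / 2 * p t x ^ 2) := by
        refine lintegral_mono fun x => ?_
        rw [two_mul_ofReal]
        refine ENNReal.ofReal_le_ofReal ?_
        rw [Real.norm_eq_abs, sq_abs, mul_pow, Real.sq_sqrt hε.le]
        have : 0 ≤ ‖u t x‖ ^ 2 := by positivity
        linarith
    _ = 2 * ∫⁻ x, ENNReal.ofReal (‖u t x‖ ^ 2 / 2 + ε / 2 * p t x ^ 2) :=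
        lintegral_const_mul' _ _ (by simp)
    _ ≤ 2 * E := by
        gcongr
        exact le_self_add.trans (ht.trans hE)

theorem eLpNorm_G_sq_le (h : EnergyInequality T ε u₀ p₀ u G p) (hT : 0 < T) {E : ℝ≥0∞}
    (hE : ∫⁻ x, ENNReal.ofReal (‖u₀ x‖ ^ 2 / 2 + ε / 2 * p₀ x ^ 2) ≤ E)
    (hG : AEStronglyMeasurable (Function.uncurry G) (slab T)) :
    eLpNorm (Function.uncurry G) 2 (slab T) ^ 2 ≤ E := by
  rw [← lintegral_ofReal_norm_sq]
  have hm : AEMeasurable (fun z => ENNReal.ofReal (‖Function.uncurry G z‖ ^ 2)) (slab T) :=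
    (hG.norm.pow 2).aemeasurable.ennreal_ofReal
  rw [slab] at hm ⊢
  rw [lintegral_prod _ hm]
  exact setLIntegral_Ioo_le_of_ae hT (h.mono fun t ht => le_add_self.trans (ht.trans hE))

end EnergyInequality

theorem mixedNorm_top_le {V : Type*} [NormedAddCommGroup V] {T : ℝ} {r C : ℝ≥0∞} {f : ℝ → E3 → V}
    (h : ∀ᵐ t ∂volume.restrict (Ioo 0 T), eLpNorm (f t) r volume ≤ C) :
    mixedNorm T ∞ r f ≤ C := by
  rw [mixedNorm, eLpNorm_exponent_top]
  exact essSup_le_of_ae_le _ (h.mono fun t ht => by simpa using ht)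

theorem ae_le_mixedNorm_top {V : Type*} [NormedAddCommGroup V] {T : ℝ} {r : ℝ≥0∞}
    (f : ℝ → E3 → V) :
    ∀ᵐ t ∂volume.restrict (Ioo 0 T), eLpNorm (f t) r volume ≤ mixedNorm T ∞ r f := by
  have := ae_le_eLpNormEssSup (f := fun t => eLpNorm (f t) r volume)
    (μ := volume.restrict (Ioo 0 T))
  simpa [mixedNorm, eLpNorm_exponent_top] using this

/-! ### Sobolev embedding and products in mixed norms -/

/-- The Sobolev inequality is applied at almost every time, so the constant depends on neither `T`
nor the solution. -/
theorem exists_mixedNorm_two_six_le : ∃ C : ℝ≥0, ∀ (T : ℝ) (u : ℝ → E3 → E3) (G : ℝ → E3 → Grad3),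
    MemMixed T ∞ 2 u → MemMixed T 2 2 G →
    (∀ᵐ t ∂volume.restrict (Ioo 0 T), IsWeakGrad (u t) (G t)) →
    mixedNorm T 2 6 u ≤ C * mixedNorm T 2 2 G := by
  obtain ⟨C, hC⟩ := exists_sobolev_const
  -- Three components with three partial derivatives each, every one bounded by the Frobenius norm
  -- of the gradient.
  refine ⟨9 * C, fun T u G hu hG hw => ?_⟩
  have su := ae_memLp_slice (by simp) (by simp) (memLp_two_of_memMixed_top hu)
  have sG := ae_memLp_slice (by simp) (by simp) (memLp_two_of_memMixed_two hG)
  refine eLpNorm_le_mul_eLpNorm_of_ae_le_mul' (c := 9 * C) ?_ 2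
  filter_upwards [su, sG, hw] with t h1 h2 h3
  simp only [enorm_eq_self]
  have h1' : MemLp (u t) 2 := h1
  have h2' : MemLp (G t) 2 := h2
  have hb : ∀ i j, eLpNorm (fun x => G t x i j) 2 volume ≤ eLpNorm (G t) 2 volume := fun i j =>
    eLpNorm_mono fun x => (PiLp.norm_apply_le (G t x i) j).trans (PiLp.norm_apply_le (G t x) i)
  calc eLpNorm (u t) 6 volume
      ≤ eLpNorm (∑ j, fun x => ‖u t x j‖) 6 volume := by
        refine eLpNorm_mono fun x => ?_
        rw [Finset.sum_apply, Real.norm_of_nonneg (Finset.sum_nonneg fun _ _ => norm_nonneg _)]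
        have e : u t x = ∑ j, u t x j • unitVec j := by
          ext j
          simp [unitVec, Pi.single_apply]
        conv_lhs => rw [e]
        refine (norm_sum_le _ _).trans (le_of_eq ?_)
        simp [norm_smul, unitVec]
    _ ≤ ∑ j, eLpNorm (fun x => ‖u t x j‖) 6 volume :=
        eLpNorm_sum_le (fun j _ => (MemLp.coord h1' j).1.norm) (by norm_num)
    _ = ∑ j, eLpNorm (fun x => u t x j) 6 volume := by simp only [eLpNorm_norm]
    _ ≤ ∑ j : Fin 3, C * ∑ i : Fin 3, eLpNorm (G t) 2 volume := by
        refine Finset.sum_le_sum fun j _ => (hC _ (fun i x => G t x i j) (MemLp.coord h1' j)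
          (fun i => MemLp.coord₂ h2' i j) fun i => h3.isWeakPartial i j).trans ?_
        gcongr with i
        exact hb i j
    _ = ↑(9 * C) * eLpNorm (G t) 2 volume := by
        simp only [Finset.sum_const, Finset.card_univ, Fintype.card_fin, nsmul_eq_mul]
        push_cast
        ring

theorem aemeasurable_eLpNorm_slice {V : Type*} [NormedAddCommGroup V] {T : ℝ} {r : ℝ≥0∞}
    (hr0 : r ≠ 0) (hr : r ≠ ∞) {f : ℝ → E3 → V}
    (hf : AEStronglyMeasurable (Function.uncurry f) (slab T)) :
    AEMeasurable (fun t => eLpNorm (f t) r volume) (volume.restrict (Ioo 0 T)) := by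
  simp only [eLpNorm_eq_lintegral_rpow_enorm_toReal hr0 hr]
  have hf' : AEStronglyMeasurable (Function.uncurry f) ((volume.restrict (Ioo 0 T)).prod volume) := hf
  exact (hf'.enorm.pow_const r.toReal).lintegral_prod_right'.pow_const _

instance : ENNReal.HolderTriple 6 2 (3 / 2) where
  inv_add_inv_eq_inv := by
    rw [ENNReal.inv_div (by simp) (by simp), ← ENNReal.toReal_eq_toReal_iff' (by simp)
      (by finiteness), ENNReal.toReal_add (by simp) (by simp)]
    simp
    norm_num

section Products

variable {T : ℝ} {u : ℝ → E3 → E3} {G : ℝ → E3 → Grad3} {f : ℝ → E3 → E3}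

/-- Hölder in space. Both nonlinear terms satisfy the pointwise bound `hfb`, so they are treated
together. -/
theorem ae_eLpNorm_product_le {q s r : ℝ≥0∞} [ENNReal.HolderTriple q s r]
    (hu : AEStronglyMeasurable (Function.uncurry u) (slab T))
    (hG : AEStronglyMeasurable (Function.uncurry G) (slab T))
    (hfb : ∀ t x, ‖f t x‖ ≤ 3 * (‖u t x‖ * ‖G t x‖)) :
    ∀ᵐ t ∂volume.restrict (Ioo 0 T),
      eLpNorm (f t) r volume ≤ 3 * (eLpNorm (u t) q volume * eLpNorm (G t) s volume) := by
  have hu' : AEStronglyMeasurable (Function.uncurry u) ((volume.restrict (Ioo 0 T)).prod volume) := hu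
  have hG' : AEStronglyMeasurable (Function.uncurry G) ((volume.restrict (Ioo 0 T)).prod volume) := hG
  filter_upwards [hu'.prodMk_left, hG'.prodMk_left] with t h1 h2
  have h3 := eLpNorm_mul_le_mul_eLpNorm (μ := (volume : Measure E3)) (p := q) (q := s) (r := r)
    (f := fun x => ‖u t x‖) (g := fun x => ‖G t x‖) h1.norm h2.norm
  rw [eLpNorm_norm, eLpNorm_norm] at h3
  refine (eLpNorm_le_mul_eLpNorm_of_ae_le_mul (c := 3) (g := fun x => ‖u t x‖ * ‖G t x‖)
    (Eventually.of_forall fun x => ?_) r).trans ?_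
  · simpa [norm_mul] using hfb t x
  · rw [ENNReal.ofReal_ofNat]
    gcongr

theorem mixedNorm_two_one_le (hu : AEStronglyMeasurable (Function.uncurry u) (slab T))
    (hG : AEStronglyMeasurable (Function.uncurry G) (slab T))
    (hfb : ∀ t x, ‖f t x‖ ≤ 3 * (‖u t x‖ * ‖G t x‖)) {A : ℝ≥0} (hA : mixedNorm T ∞ 2 u ≤ A) :
    mixedNorm T 2 1 f ≤ 3 * A * mixedNorm T 2 2 G := by
  refine eLpNorm_le_mul_eLpNorm_of_ae_le_mul' (c := 3 * A) ?_ 2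
  filter_upwards [ae_eLpNorm_product_le (q := 2) (s := 2) (r := 1) hu hG hfb,
    ae_le_mixedNorm_top (r := 2) (T := T) u] with t h1 h2
  simp only [enorm_eq_self]
  refine h1.trans ?_
  push_cast
  rw [mul_assoc]
  gcongr
  exact h2.trans hA

/-- Hölder in space with `1/6 + 1/2 = 2/3`, then Cauchy–Schwarz in time. -/
theorem mixedNorm_one_three_half_le (hu : AEStronglyMeasurable (Function.uncurry u) (slab T))
    (hG : AEStronglyMeasurable (Function.uncurry G) (slab T))
    (hfb : ∀ t x, ‖f t x‖ ≤ 3 * (‖u t x‖ * ‖G t x‖)) :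
    mixedNorm T 1 (3 / 2) f ≤ 3 * (mixedNorm T 2 6 u * mixedNorm T 2 2 G) := by
  rw [mixedNorm, eLpNorm_one_eq_lintegral_enorm]
  simp only [enorm_eq_self]
  calc ∫⁻ t in Ioo 0 T, eLpNorm (f t) (3 / 2) volume
      ≤ ∫⁻ t in Ioo 0 T, 3 * (eLpNorm (u t) 6 volume * eLpNorm (G t) 2 volume) :=
        lintegral_mono_ae (ae_eLpNorm_product_le hu hG hfb)
    _ = 3 * ∫⁻ t in Ioo 0 T, eLpNorm (u t) 6 volume * eLpNorm (G t) 2 volume :=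
        lintegral_const_mul' _ _ (by simp)
    _ ≤ _ := by
        gcongr
        have := ENNReal.lintegral_mul_le_Lp_mul_Lq (volume.restrict (Ioo 0 T))
          (Real.HolderConjugate.two_two)
          (aemeasurable_eLpNorm_slice (r := 6) (by simp) (by simp) hu)
          (aemeasurable_eLpNorm_slice (r := 2) (by simp) (by simp) hG)
        simpa [mixedNorm, eLpNorm_eq_lintegral_rpow_enorm_toReal (p := 2)] using this

theorem norm_convec_le (v : E3) (g : Grad3) : ‖convec v g‖ ≤ 3 * (‖v‖ * ‖g‖) := by
  refine (norm_sum_le _ _).trans ?_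
  calc ∑ i, ‖v i • g i‖ ≤ ∑ _i : Fin 3, ‖v‖ * ‖g‖ := by
        refine Finset.sum_le_sum fun i _ => ?_
        rw [norm_smul]
        exact mul_le_mul (PiLp.norm_apply_le v i) (PiLp.norm_apply_le g i) (norm_nonneg _)
          (norm_nonneg _)
    _ = 3 * (‖v‖ * ‖g‖) := by simp

theorem norm_divg_smul_le (v : E3) (g : Grad3) : ‖divg g • v‖ ≤ 3 * (‖v‖ * ‖g‖) := by
  rw [norm_smul]
  have : ‖divg g‖ ≤ 3 * ‖g‖ := by
    refine (norm_sum_le _ _).trans ?_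
    calc ∑ i, ‖g i i‖ ≤ ∑ _i : Fin 3, ‖g‖ := Finset.sum_le_sum fun i _ =>
          (PiLp.norm_apply_le (g i) i).trans (PiLp.norm_apply_le g i)
      _ = 3 * ‖g‖ := by simp
  calc ‖divg g‖ * ‖v‖ ≤ 3 * ‖g‖ * ‖v‖ := by gcongr
    _ = _ := by ring

theorem continuous_convec : Continuous fun w : E3 × Grad3 => convec w.1 w.2 := by
  unfold convec
  fun_prop

theorem continuous_divg_smul : Continuous fun w : E3 × Grad3 => divg w.2 • w.1 := by
  unfold divg
  fun_prop

theorem boundedMixed_product {u : ℕ → ℝ → E3 → E3} {G : ℕ → ℝ → E3 → Grad3}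
    {b : E3 → Grad3 → E3} (hb : Continuous fun w : E3 × Grad3 => b w.1 w.2)
    (hbb : ∀ v g, ‖b v g‖ ≤ 3 * (‖v‖ * ‖g‖)) (hu : BoundedMixed T ∞ 2 u)
    (hu' : BoundedMixed T 2 6 u) (hG : BoundedMixed T 2 2 G) :
    BoundedMixed T 2 1 (fun n t x => b (u n t x) (G n t x)) ∧
      BoundedMixed T 1 (3 / 2) (fun n t x => b (u n t x) (G n t x)) := by
  obtain ⟨mu, A, hA⟩ := hu
  obtain ⟨-, B, hB⟩ := hu'
  obtain ⟨mG, C, hC⟩ := hG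
  have hm : ∀ n, AEStronglyMeasurable (Function.uncurry fun t x => b (u n t x) (G n t x)) (slab T) :=
    fun n => hb.comp_aestronglyMeasurable ((mu n).1.prodMk (mG n).1)
  have h1 : ∀ n, mixedNorm T 2 1 (fun t x => b (u n t x) (G n t x)) ≤ (3 * A * C : ℝ≥0) := fun n => by
    refine (mixedNorm_two_one_le (mu n).1 (mG n).1 (fun t x => hbb _ _) (hA n)).trans ?_
    push_cast
    gcongr
    exact hC n
  have h2 : ∀ n, mixedNorm T 1 (3 / 2) (fun t x => b (u n t x) (G n t x))
      ≤ (3 * (B * C) : ℝ≥0) := fun n => by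
    refine (mixedNorm_one_three_half_le (mu n).1 (mG n).1 (fun t x => hbb _ _)).trans ?_
    push_cast
    gcongr
    · exact hB n
    · exact hC n
  exact ⟨⟨fun n => ⟨hm n, (h1 n).trans_lt ENNReal.coe_lt_top⟩, _, h1⟩,
    ⟨fun n => ⟨hm n, (h2 n).trans_lt ENNReal.coe_lt_top⟩, _, h2⟩⟩

end Products

/-! ### Time derivatives in `H⁻¹` -/

/-- The embedding of scalars as the time-derivative component of a jet. -/
def jetTime : ℝ →L[ℝ] Jet :=
  LinearMap.toContinuousLinearMap
    { toFun := fun r => WithLp.toLp 2 (0, WithLp.toLp 2 (r, 0))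
      map_add' := fun r s => by
        rw [← WithLp.toLp_add, Prod.mk_add_mk, ← WithLp.toLp_add, Prod.mk_add_mk]
        simp
      map_smul' := fun c r => by
        rw [RingHom.id_apply, ← WithLp.toLp_smul, Prod.smul_mk, ← WithLp.toLp_smul, Prod.smul_mk]
        simp }

theorem inner_jetTime (r : ℝ) (φ : ℝ × E3 → ℝ) (z : ℝ × E3) :
    inner ℝ (jetTime r) (jet φ z) = r * dt φ z := by
  simp [jetTime, jet, WithLp.prod_inner_apply, mul_comm]

/-- The distributional time derivative of a square-integrable function, as an element
of `H⁻¹((0,T) × ℝ³)`. -/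
def timeDeriv (T : ℝ) (g : Lp ℝ 2 (slab T)) : Hm1 T :=
  -- Pairing the jet `(0, g, 0)` with `(φ, ∂ₜφ, ∇φ)` leaves `∫ g ∂ₜφ`; the minus sign is that of the
  -- distributional derivative.
  -((innerSL ℝ (jetTime.compLpL 2 (slab T) g)).comp (H10 T).subtypeL)

theorem continuous_timeDeriv (T : ℝ) : Continuous (timeDeriv T) := by
  unfold timeDeriv
  fun_prop

theorem timeDeriv_zero (T : ℝ) : timeDeriv T 0 = 0 := by
  simp [timeDeriv]

theorem isTimeDeriv_timeDeriv {T : ℝ} {f : ℝ → E3 → ℝ}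
    (hf : MemLp (Function.uncurry f) 2 (slab T)) :
    IsTimeDeriv T f (timeDeriv T (hf.toLp _)) := by
  intro φ hφ
  have : timeDeriv T (hf.toLp _) hφ.toH10
      = -inner ℝ (jetTime.compLpL 2 (slab T) (hf.toLp _)) (hφ.memLp_jet.toLp (jet φ)) := rfl
  rw [this, L2.inner_def]
  congr 1
  refine integral_congr_ae ?_
  filter_upwards [jetTime.coeFn_compLpL (hf.toLp _), hf.coeFn_toLp, hφ.memLp_jet.coeFn_toLp]
    with z h1 h2 h3
  rw [h1, h2, h3, inner_jetTime]
  rfl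

/-! ### Uniform initial energy and compactness of `ε ∂ₜp`. -/

/-- Convergence alone bounds only a tail; finiteness of each term covers the remaining indices. -/
theorem exists_bound_of_tendsto_zero {a : ℕ → ℝ≥0∞} (ha : ∀ n, a n ≠ ∞)
    (h : Tendsto a atTop (𝓝 0)) : ∃ C : ℝ≥0, ∀ n, a n ≤ C := by
  have h1 := (ENNReal.tendsto_toNNReal ENNReal.zero_ne_top).comp h
  obtain ⟨C, hC⟩ := h1.bddAbove_range
  refine ⟨C, fun n => ?_⟩
  have := hC (mem_range_self n)
  rw [← ENNReal.coe_toNNReal (ha n)]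
  exact_mod_cast this

theorem exists_initial_energy_bound {ε : ℕ → ℝ} (hε : ∀ n, 0 < ε n) {u₀ : ℕ → E3 → E3}
    {p₀ : ℕ → E3 → ℝ} (hu₀ : ∀ n, MemLp (u₀ n) 2) (hp₀ : ∀ n, MemLp (p₀ n) 2) {w₀ : E3 → E3}
    (hw₀ : MemLp w₀ 2)
    (hIDu : Tendsto (fun n => eLpNorm (fun x => u₀ n x - w₀ x) 2 volume) atTop (𝓝 0))
    (hIDp : Tendsto (fun n => eLpNorm (fun x => √(ε n) * p₀ n x) 2 volume) atTop (𝓝 0)) :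
    ∃ E : ℝ≥0, ∀ n,
      ∫⁻ x, ENNReal.ofReal (‖u₀ n x‖ ^ 2 / 2 + ε n / 2 * p₀ n x ^ 2) ≤ E := by
  obtain ⟨A, hA⟩ := exists_bound_of_tendsto_zero (fun n => ((hu₀ n).sub hw₀).2.ne) hIDu
  obtain ⟨B, hB⟩ := exists_bound_of_tendsto_zero (fun n => ((hp₀ n).const_mul _).2.ne) hIDp
  refine ⟨(A + (eLpNorm w₀ 2 volume).toNNReal) ^ 2 + B ^ 2, fun n => ?_⟩
  have hu : eLpNorm (u₀ n) 2 volume ≤ A + eLpNorm w₀ 2 volume := by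
    have e : u₀ n = (fun x => u₀ n x - w₀ x) + w₀ := by ext1 x; simp
    rw [e]
    exact (eLpNorm_add_le ((hu₀ n).1.sub hw₀.1) hw₀.1 one_le_two).trans (by gcongr; exact hA n)
  calc ∫⁻ x, ENNReal.ofReal (‖u₀ n x‖ ^ 2 / 2 + ε n / 2 * p₀ n x ^ 2)
      ≤ ∫⁻ x, (ENNReal.ofReal (‖u₀ n x‖ ^ 2) + ENNReal.ofReal (‖√(ε n) * p₀ n x‖ ^ 2)) := by
        refine lintegral_mono fun x => ?_
        rw [← ENNReal.ofReal_add (by positivity) (by positivity)]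
        refine ENNReal.ofReal_le_ofReal ?_
        rw [Real.norm_eq_abs, sq_abs, mul_pow, Real.sq_sqrt (hε n).le]
        have h1 : 0 ≤ ‖u₀ n x‖ ^ 2 := by positivity
        have h2 : 0 ≤ ε n * p₀ n x ^ 2 := mul_nonneg (hε n).le (sq_nonneg _)
        linarith
    _ = eLpNorm (u₀ n) 2 volume ^ 2 + eLpNorm (fun x => √(ε n) * p₀ n x) 2 volume ^ 2 := by
        rw [lintegral_add_left' (show AEMeasurable (fun x => ENNReal.ofReal (‖u₀ n x‖ ^ 2)) volume from
            ((hu₀ n).1.norm.pow 2).aemeasurable.ennreal_ofReal),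
          lintegral_ofReal_norm_sq, lintegral_ofReal_norm_sq]
    _ ≤ (A + eLpNorm w₀ 2 volume) ^ 2 + (B : ℝ≥0∞) ^ 2 := by
        gcongr
        exact hB n
    _ = _ := by
        push_cast
        rw [ENNReal.coe_toNNReal hw₀.2.ne]

/-- Since `ε p = √ε (√ε p)` with the second factor bounded in `L²` of the slab, `ε p` tends to `0`
there, and `timeDeriv` preserves the convergence. -/
theorem exists_compact_timeDeriv {T : ℝ} {ε : ℕ → ℝ} (hε : ∀ n, 0 < ε n)
    (hε0 : Tendsto ε atTop (𝓝 0)) {p : ℕ → ℝ → E3 → ℝ}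
    (hp : BoundedMixed T ∞ 2 (fun n t x => √(ε n) * p n t x)) :
    ∃ Λ : ℕ → Hm1 T, (∀ n, IsTimeDeriv T (fun t x => ε n * p n t x) (Λ n)) ∧
      IsCompact (closure (range Λ)) := by
  obtain ⟨hm, C, hC⟩ := hp
  have e : ∀ n, (Function.uncurry fun t x => ε n * p n t x)
      = √(ε n) • Function.uncurry fun t x => √(ε n) * p n t x := fun n => by
    ext z
    simp only [Function.uncurry, Pi.smul_apply, smul_eq_mul, ← mul_assoc,
      Real.mul_self_sqrt (hε n).le]
  have hmem : ∀ n, MemLp (Function.uncurry fun t x => ε n * p n t x) 2 (slab T) := fun n => by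
    rw [e n]
    exact (memLp_two_of_memMixed_top (hm n)).const_smul _
  have hb : ∀ n, eLpNorm (Function.uncurry fun t x => ε n * p n t x) 2 (slab T)
      ≤ ENNReal.ofReal √(ε n) * (C * volume (Ioo 0 T) ^ (1 / (2 : ℝ))) := fun n => by
    rw [e n, eLpNorm_const_smul, Real.enorm_eq_ofReal (Real.sqrt_nonneg _)]
    gcongr
    exact (eLpNorm_uncurry_le_mixedNorm_top (hm n).1).trans (by gcongr; exact hC n)
  refine ⟨fun n => timeDeriv T ((hmem n).toLp _), fun n => isTimeDeriv_timeDeriv (hmem n), ?_⟩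
  have h0 : Tendsto (fun n => (hmem n).toLp _) atTop (𝓝 (0 : Lp ℝ 2 (slab T))) := by
    rw [tendsto_iff_edist_tendsto_0]
    have h1 : Tendsto (fun n => ENNReal.ofReal √(ε n) * (C * volume (Ioo 0 T) ^ (1 / (2 : ℝ))))
        atTop (𝓝 0) := by
      have h2 : Tendsto (fun n => ENNReal.ofReal √(ε n)) atTop (𝓝 0) := by
        simpa using ENNReal.tendsto_ofReal ((Real.continuous_sqrt.tendsto 0).comp hε0)
      have h3 := ENNReal.Tendsto.mul_const (b := C * volume (Ioo 0 T) ^ (1 / (2 : ℝ))) h2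
        (Or.inr (ENNReal.mul_ne_top (by simp)
          (ENNReal.rpow_lt_top_of_nonneg (by positivity) (by simp)).ne))
      simpa using h3
    refine tendsto_of_tendsto_of_tendsto_of_le_of_le tendsto_const_nhds h1 (fun _ => zero_le)
      fun n => ?_
    simp only [edist_zero_right, Lp.enorm_def]
    rw [eLpNorm_congr_ae (hmem n).coeFn_toLp]
    exact hb n
  have h1 : Tendsto (fun n => timeDeriv T ((hmem n).toLp _)) atTop (𝓝 0) := by
    have := ((continuous_timeDeriv T).tendsto 0).comp h0
    rwa [timeDeriv_zero] at this
  -- A convergent sequence together with its limit is compact.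
  exact h1.isCompact_insert_range.closure_of_subset (subset_insert _ _)

end

end ArtComp

open ArtComp in
theorem corollary4p2 (T : ℝ) (hT : 0 < T)
    (ε : ℕ → ℝ) (hε : ∀ n, 0 < ε n) (hε0 : Tendsto ε atTop (𝓝 0))
    (u₀ : ℕ → E3 → E3) (p₀ : ℕ → E3 → ℝ)
    (u : ℕ → ℝ → E3 → E3) (G : ℕ → ℝ → E3 → Grad3) (p : ℕ → ℝ → E3 → ℝ)
    (hsol : ∀ n, IsWeakSolution T (ε n) (u₀ n) (p₀ n) (u n) (G n) (p n))
    -- the solution lies in `L⁴`, or it satisfies the energy inequality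
    (hfin : ∀ n, MemLp (Function.uncurry (u n)) 4 (slab T) ∨
      EnergyInequality T (ε n) (u₀ n) (p₀ n) (u n) (G n) (p n))
    -- the initial data converge in the energy space
    (w₀ : E3 → E3) (hw₀ : MemLp w₀ 2 volume)
    (hIDu : Tendsto (fun n => eLpNorm (fun x => u₀ n x - w₀ x) 2 volume) atTop (𝓝 0))
    (hIDp : Tendsto (fun n => eLpNorm (fun x => √(ε n) * p₀ n x) 2 volume) atTop (𝓝 0)) :
    BoundedMixed T ∞ 2 (fun n t x => √(ε n) * p n t x) ∧
    (∃ Λ : ℕ → Hm1 T, (∀ n, IsTimeDeriv T (fun t x => ε n * p n t x) (Λ n)) ∧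
      IsCompact (closure (range Λ))) ∧
    ((∀ n, MemLp (Function.uncurry (G n)) 2 (slab T)) ∧
      ∃ C : ℝ≥0, ∀ n, eLpNorm (Function.uncurry (G n)) 2 (slab T) ≤ C) ∧
    (BoundedMixed T ∞ 2 u ∧ BoundedMixed T 2 6 u) ∧
    (BoundedMixed T 2 1 (fun n t x => convec (u n t x) (G n t x)) ∧
      BoundedMixed T 1 (3 / 2) (fun n t x => convec (u n t x) (G n t x))) ∧
    (BoundedMixed T 2 1 (fun n t x => divg (G n t x) • u n t x) ∧
      BoundedMixed T 1 (3 / 2) (fun n t x => divg (G n t x) • u n t x)) := by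
  -- From here on the two alternatives of `hfin` are no longer distinguished.
  have hen : ∀ n, EnergyInequality T (ε n) (u₀ n) (p₀ n) (u n) (G n) (p n) := fun n =>
    (hfin n).elim (fun h4 => (hsol n).energyInequality hT (hε n) h4) id
  obtain ⟨E, hE⟩ := exists_initial_energy_bound hε (fun n => (hsol n).u₀_mem)
    (fun n => (hsol n).p₀_mem) hw₀ hIDu hIDp
  have hp : BoundedMixed T ∞ 2 (fun n t x => √(ε n) * p n t x) :=
    -- The energy controls half of the squared norm, whence `2 * E`.
    ⟨fun n => (hsol n).p_mem, 2 * E + 1, fun n => mixedNorm_top_le <| by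
      filter_upwards [(hen n).ae_eLpNorm_p_sq_le (hε n) (hE n)] with t ht
      push_cast
      exact (le_sq_add_one _).trans (by gcongr)⟩
  have hu : BoundedMixed T ∞ 2 u :=
    ⟨fun n => (hsol n).u_mem, 2 * E + 1, fun n => mixedNorm_top_le <| by
      filter_upwards [(hen n).ae_eLpNorm_u_sq_le (hε n) (hE n)] with t ht
      push_cast
      exact (le_sq_add_one _).trans (by gcongr)⟩
  have hGb : ∀ n, eLpNorm (Function.uncurry (G n)) 2 (slab T) ≤ (E + 1 : ℝ≥0) := fun n => by
    push_cast
    refine (le_sq_add_one _).trans ?_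
    gcongr
    exact (hen n).eLpNorm_G_sq_le hT (hE n) (hsol n).G_mem.1
  have hG : BoundedMixed T 2 2 G :=
    ⟨fun n => (hsol n).G_mem, E + 1, fun n => by
      rw [mixedNorm_two_two_eq (hsol n).G_mem.1]
      exact hGb n⟩
  obtain ⟨C, hC⟩ := exists_mixedNorm_two_six_le
  have hu6b : ∀ n, mixedNorm T 2 6 (u n) ≤ (C * (E + 1) : ℝ≥0) := fun n => by
    refine (hC T (u n) (G n) (hsol n).u_mem (hsol n).G_mem (hsol n).grad).trans ?_
    rw [mixedNorm_two_two_eq (hsol n).G_mem.1, ENNReal.coe_mul]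
    gcongr
    exact hGb n
  have hu6 : BoundedMixed T 2 6 u :=
    ⟨fun n => ⟨(hsol n).u_mem.1, (hu6b n).trans_lt ENNReal.coe_lt_top⟩, _, hu6b⟩
  exact ⟨hp, exists_compact_timeDeriv hε hε0 hp,
    ⟨fun n => memLp_two_of_memMixed_two (hsol n).G_mem, E + 1, hGb⟩, ⟨hu, hu6⟩,
    boundedMixed_product continuous_convec norm_convec_le hu hu6 hG,
    boundedMixed_product (b := fun v g => divg g • v) continuous_divg_smul norm_divg_smul_le
      hu hu6 hG⟩
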